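/- Conventions. A \emph{filtered bundle of degree $l$} is a smooth fibre bundle $\pi: F\to M$ over a smooth manifold with typical fibre $\mathbb{R}^N$, together with an atlas of local trivializations whose fibre coordinates $X^I$ carry weights $w_I\in\{1,\dots,l\}$ (the list of weights being the same for all trivializations), such that under every change of trivialization $X^{I'}$ is a polynomial in the coordinates $X^J$, with coefficients smooth functions on the base, of weighted degree at most $w_{I'}$. A \emph{double filtered bundle of bi-degree $(k,l)$} is defined in the same way, with bi-weights $(u,v)\in\big([0,k]\times[0,l]\big)\setminus\{(0,0)\}$ assigned to the fibre coordinates, each coordinate change being of weighted degree at most $u$ with respect to the first weight and at most $v$ with respect to the second. A \emph{morphism} of (double) filtered bundles covering a smooth map $f$ of the bases is a map $\phi$ of the total spaces over $f$ such that the pull-back of every adapted fibre coordinate of the target is locally a polynomial in the adapted fibre coordinates of the source, with coefficients smooth functions on the base, whose weighted degree (with respect to each weight) is at most the corresponding weight of that coordinate. For a filtered bundle $F\to M$ let $J^kF\to M$ be the bundle of $k$-jets of local sections of $F\to M$. Base coordinates $(x^a)$ and adapted fibre coordinates $(X^I)$ induce on it the jet coordinates $X^I_{\beta}(j^k_xs)=\partial^{\beta}(X^I\circ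 s)(x)$, $|\beta|\le k$, to which the bi-weight $(w_I,|\beta|)$ is assigned. Theorem. Let $k\ge 0$, let $F\to M$ and $F'\to M'$ be filtered bundles of degrees $l$ and $m$, and let $\phi:F\to F'$ be a morphism of filtered bundles covering a diffeomorphism $f:M\to M'$. Then, with the jet coordinates and bi-weights above, $J^kF$ and $J^kF'$ are double filtered bundles of bi-degrees $(l,k)$ and $(m,k)$ respectively, and the jet prolongation $$J^k\phi: J^kF\to J^kF',\qquad J^k\phi(j^k_xs)=j^k_{f(x)}(\phi\circ s\circ f^{-1}),$$ is a morphism of double filtered bundles covering $f$. -/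

import Mathlib

open scoped Manifold ContDiff Topology

noncomputable section

/-- An (as yet unconstrained) system of weighted local fibre coordinates for a projection
`proj : E → M` onto an `n`-dimensional manifold. The charts are indexed by `C`; the chart `c` lives
over `domain c ⊆ M`, and `coord c p i` is the `i`-th fibre coordinate of the point `p` lying over
`domain c` (values outside are junk and never used). The fibre coordinate with label `i : ι` has an
`r`-tuple of weights `weight i`. The base coordinates are the charts of the manifold `M`. -/
structure FibreAtlas (n r : ℕ) (M E C ι : Type*) [TopologicalSpace M]
    [ChartedSpace (EuclideanSpace ℝ (Fin n)) M] where
  proj : E → M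
  domain : C → Set M
  coord : C → E → ι → ℝ
  weight : ι → Fin r → ℕ

namespace FibreAtlas

variable {n n' r k : ℕ} {M M' E E' C C' ι ι' : Type*}
  [TopologicalSpace M] [ChartedSpace (EuclideanSpace ℝ (Fin n)) M]
  [TopologicalSpace M'] [ChartedSpace (EuclideanSpace ℝ (Fin n')) M']

/-- The map `Φ : E → E'` covering `f : M → M'`, read in the fibre coordinates `c` of `E` and `c'` of
`E'`, is polynomial in the fibre coordinates, with coefficients that are smooth functions on the
base, and it respects each of the `r` weights: the pull-back of a fibre coordinate of weights
`(u₁, …, uᵣ)` is a polynomial of weighted degree at most `uₐ` with respect to the `a`-th weight, for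
every `a`. -/
def IsFilteredPolynomial (A : FibreAtlas n r M E C ι) (A' : FibreAtlas n' r M' E' C' ι')
    (Φ : E → E') (f : M → M') (c : C) (c' : C') : Prop :=
  ∃ P : ι' → M → MvPolynomial ι ℝ,
    (∀ i d, ContMDiffOn (𝓡 n) 𝓘(ℝ, ℝ) ∞ (fun x => (P i x).coeff d)
      (A.domain c ∩ f ⁻¹' A'.domain c')) ∧
    (∀ i, ∀ x ∈ A.domain c ∩ f ⁻¹' A'.domain c', ∀ a,
      (P i x).weightedTotalDegree (fun j => A.weight j a) ≤ A'.weight i a) ∧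
    ∀ p, A.proj p ∈ A.domain c ∩ f ⁻¹' A'.domain c' → ∀ i,
      A'.coord c' (Φ p) i = MvPolynomial.eval (A.coord c p) (P i (A.proj p))

/-- `E → M` with the given weighted fibre coordinates is an `r`-tuple filtered bundle of multi-degree
`deg`: a locally trivial bundle with typical fibre `ℝ^ι`, whose adapted fibre coordinates have
non-zero weights bounded by `deg`, and whose admissible changes of coordinates are polynomial in the
fibre coordinates, with coefficients smooth on the base, and respect every weight. (In particular
the transition maps are smooth, so `E` carries the smooth structure for which the local
trivializations are diffeomorphisms.) -/
structure IsMultiFilteredBundle [TopologicalSpace E] (A : FibreAtlas n r M E C ι)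
    (deg : Fin r → ℕ) : Prop where
  finite_rank : Finite ι
  weight_ne_zero : ∀ i, A.weight i ≠ 0
  weight_le : ∀ i a, A.weight i a ≤ deg a
  trivialization : ∀ c, ∃ e : Bundle.Trivialization (ι → ℝ) A.proj, e.baseSet = A.domain c ∧
    ∀ p ∈ e.source, e p = (A.proj p, A.coord c p)
  cover : ∀ x, ∃ c, x ∈ A.domain c
  transition : ∀ c c', A.IsFilteredPolynomial A id id c c'

theorem IsMultiFilteredBundle.isOpen_domain [TopologicalSpace E] {A : FibreAtlas n r M E C ι}
    {deg : Fin r → ℕ} (hA : A.IsMultiFilteredBundle deg) (c : C) :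
    IsOpen (A.domain c) := by
  obtain ⟨e, he, -⟩ := hA.trivialization c
  rw [← he]
  exact e.open_baseSet

/-- A filtered bundle of degree `l`. -/
abbrev IsFilteredBundle [TopologicalSpace E] (A : FibreAtlas n 1 M E C ι) (l : ℕ) : Prop :=
  A.IsMultiFilteredBundle ![l]

/-- A double filtered bundle of bi-degree `(k, l)`. -/
abbrev IsDoubleFilteredBundle [TopologicalSpace E] (A : FibreAtlas n 2 M E C ι) (k l : ℕ) : Prop :=
  A.IsMultiFilteredBundle ![k, l]

/-- `Φ : E → E'` is a morphism of `r`-tuple filtered bundles covering `f : M → M'`. -/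
structure IsMorphism (A : FibreAtlas n r M E C ι) (A' : FibreAtlas n' r M' E' C' ι')
    (Φ : E → E') (f : M → M') : Prop where
  smooth_base : ContMDiff (𝓡 n) (𝓡 n') ∞ f
  proj_comp : ∀ p, A'.proj (Φ p) = f (A.proj p)
  polynomial : ∀ c c', A.IsFilteredPolynomial A' Φ f c c'

/-! ### Jets of local sections -/

section Jets

variable [Fintype ι]

/-- `s` is a smooth section on some open neighbourhood of `x` (its values further away from `x` are
irrelevant). -/
def IsSectionNear (A : FibreAtlas n r M E C ι) (x : M) (s : M → E) : Prop :=
  ∃ U : Set M, IsOpen U ∧ x ∈ U ∧ (∀ y ∈ U, A.proj (s y) = y) ∧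
    ∀ c, ContMDiffOn (𝓡 n) 𝓘(ℝ, ι → ℝ) ∞ (fun y => A.coord c (s y)) (U ∩ A.domain c)

/-- Smooth local sections of `E → M` defined near `x`. -/
def LocalSection (A : FibreAtlas n r M E C ι) (x : M) : Type _ :=
  {s : M → E // A.IsSectionNear x s}

/-- The fibre coordinates of `s` in the chart `c`, as functions of the base coordinates `χ`. -/
def localRep (A : FibreAtlas n r M E C ι)
    (χ : OpenPartialHomeomorph M (EuclideanSpace ℝ (Fin n))) (c : C) (s : M → E) :
    EuclideanSpace ℝ (Fin n) → ι → ℝ :=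
  fun z => A.coord c (s (χ.symm z))

/-- Two local sections have contact of order `k` at `x`: in all local coordinates around `x`, all
their partial derivatives of order at most `k` agree at `x`. -/
def SameJet (A : FibreAtlas n r M E C ι) (k : ℕ) (x : M) (s t : M → E) : Prop :=
  ∀ χ ∈ IsManifold.maximalAtlas (𝓡 n) ∞ M, ∀ c, x ∈ χ.source → x ∈ A.domain c → ∀ q ≤ k,
    iteratedFDeriv ℝ q (A.localRep χ c s) (χ x) = iteratedFDeriv ℝ q (A.localRep χ c t) (χ x)

def jetSetoid (A : FibreAtlas n r M E C ι) (k : ℕ) (x : M) : Setoid (A.LocalSection x) where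
  r s t := A.SameJet k x s.1 t.1
  iseqv :=
    { refl := fun _ _ _ _ _ _ _ _ => rfl
      symm := fun h χ hχ c hx hc q hq => (h χ hχ c hx hc q hq).symm
      trans := fun h h' χ hχ c hx hc q hq =>
        (h χ hχ c hx hc q hq).trans (h' χ hχ c hx hc q hq) }

/-- The `k`-th jet bundle `J^k E`: the `k`-jets of local sections at all points of `M`. -/
def JetSpace (A : FibreAtlas n r M E C ι) (k : ℕ) : Type _ :=
  Σ x : M, Quotient (A.jetSetoid k x)

/-- The `k`-jet at `x` of a local section. -/
def jet (A : FibreAtlas n r M E C ι) (k : ℕ) (x : M) (s : A.LocalSection x) : A.JetSpace k :=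
  ⟨x, Quotient.mk (A.jetSetoid k x) s⟩

end Jets

end FibreAtlas

/-- Multi-indices of order at most `k` in `n` variables. -/
abbrev MultiIndexLE (n k : ℕ) : Type := {β : Fin n → ℕ // ∑ a, β a ≤ k}

/-- The partial derivative `∂^β u` at `z`, that is, the iterated derivative of order `|β|` evaluated
on the list of directions in which each basis vector `e_a` occurs `β a` times. -/
def multiIndexDeriv {n : ℕ} {ι : Type*} [Fintype ι] (β : Fin n → ℕ)
    (u : EuclideanSpace ℝ (Fin n) → ι → ℝ) (z : EuclideanSpace ℝ (Fin n)) : ι → ℝ :=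
  iteratedFDeriv ℝ (∑ a, β a) u z
    (fun j => EuclideanSpace.single (finSigmaFinEquiv.symm j).1 (1 : ℝ))

namespace FibreAtlas

variable {n n' r k : ℕ} {M M' E E' C C' ι ι' : Type*}
  [TopologicalSpace M] [ChartedSpace (EuclideanSpace ℝ (Fin n)) M]
  [TopologicalSpace M'] [ChartedSpace (EuclideanSpace ℝ (Fin n')) M'] [Fintype ι] [Fintype ι']

open Classical in
/-- The jet coordinates `Y^i_β (j^k_x s) = ∂^β (Y^i ∘ s)`, `|β| ≤ k`, induced by the base chart `χ`
and the fibre coordinates `c`. -/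
def jetCoord (A : FibreAtlas n r M E C ι) (k : ℕ)
    (χ : IsManifold.maximalAtlas (𝓡 n) ∞ M) (c : C) (p : A.JetSpace k) :
    ι × MultiIndexLE n k → ℝ :=
  if h : p.1 ∈ χ.1.source ∩ A.domain c then
    fun iβ => Quotient.lift
      (fun s : A.LocalSection p.1 => multiIndexDeriv iβ.2.1 (A.localRep χ.1 c s.1) (χ.1 p.1) iβ.1)
      (fun s t (hst : A.SameJet k p.1 s.1 t.1) => by
        simp only [multiIndexDeriv]
        rw [hst χ.1 χ.2 c h.1 h.2 _ iβ.2.2]) p.2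
  else 0

/-- The jet bundle `J^k E → M` of a filtered bundle `E`, with the jet coordinates induced by all
smooth charts of `M` and all adapted fibre coordinates of `E`. The coordinate `Y^i_β` has bi-weight
`(w, |β|)`, where `w` is the weight of `Y^i`. -/
def jetAtlas (A : FibreAtlas n 1 M E C ι) (k : ℕ) :
    FibreAtlas n 2 M (A.JetSpace k) (IsManifold.maximalAtlas (𝓡 n) ∞ M × C)
      (ι × MultiIndexLE n k) where
  proj p := p.1
  domain χc := χc.1.1.source ∩ A.domain χc.2
  coord χc p := A.jetCoord k χc.1 χc.2 p
  weight iβ := ![A.weight iβ.1 0, ∑ a, iβ.2.1 a]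

/-- The topology of the jet bundle: it is generated by the sets that are described by open
conditions in jet coordinates. -/
instance jetSpaceTopology (A : FibreAtlas n 1 M E C ι) (k : ℕ) : TopologicalSpace (A.JetSpace k) :=
  TopologicalSpace.generateFrom
    {V | ∃ χc, ∃ W : Set (M × (ι × MultiIndexLE n k → ℝ)), IsOpen W ∧
      V = {p | (A.jetAtlas k).proj p ∈ (A.jetAtlas k).domain χc ∧
        ((A.jetAtlas k).proj p, (A.jetAtlas k).coord χc p) ∈ W}}

/-! ### Jet prolongation of morphisms -/

section Prolongation

variable [TopologicalSpace E] [TopologicalSpace E'] {deg deg' : Fin r → ℕ}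
  {A : FibreAtlas n r M E C ι} {A' : FibreAtlas n' r M' E' C' ι'}

/-- Evaluation of a filtered polynomial with smooth coefficients is smooth. -/
theorem contMDiffAt_eval {N₀ : ℕ∞ω} {F : Type*} [NormedAddCommGroup F] [NormedSpace ℝ F]
    {H : Type*} [TopologicalSpace H] (J : ModelWithCorners ℝ F H) {N : Type*}
    [TopologicalSpace N] [ChartedSpace H N]
    (w : ι → Fin r → ℕ) (hw : ∀ i, w i ≠ 0) (w' : Fin r → ℕ) (V : Set M) (hV : IsOpen V)
    (P : M → MvPolynomial ι ℝ)
    (hP : ∀ d, ContMDiffOn (𝓡 n) 𝓘(ℝ, ℝ) N₀ (fun x => (P x).coeff d) V)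
    (hdeg : ∀ x ∈ V, ∀ a, (P x).weightedTotalDegree (fun j => w j a) ≤ w' a)
    (g : N → M) (v : N → ι → ℝ) (y : N) (hy : g y ∈ V) (hg : ContMDiffAt J (𝓡 n) N₀ g y)
    (hv : ContMDiffAt J 𝓘(ℝ, ι → ℝ) N₀ v y) :
    ContMDiffAt J 𝓘(ℝ, ℝ) N₀ (fun q => MvPolynomial.eval (v q) (P (g q))) y := by
  classical
  set D : Finset (ι →₀ ℕ) :=
    Finset.Iic (Finsupp.equivFunOnFinite.symm fun _ => ∑ a, w' a) with hD
  have hsub : ∀ x ∈ V, (P x).support ⊆ D := by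
    intro x hx d hd
    rw [hD, Finset.mem_Iic]
    intro j
    obtain ⟨a, ha⟩ : ∃ a, w j a ≠ 0 := by
      by_contra! h
      exact hw j (funext h)
    have h1 := MvPolynomial.le_weightedTotalDegree (fun j => w j a) hd
    have h2 := hdeg x hx a
    have h3 : d j ≤ Finsupp.weight (fun j => w j a) d := Finsupp.le_weight (fun j => w j a) ha d
    have h4 : w' a ≤ ∑ a, w' a := Finset.single_le_sum (fun _ _ => Nat.zero_le _) (Finset.mem_univ a)
    simpa using h3.trans (h1.trans (h2.trans h4))
  have heq : (fun q => MvPolynomial.eval (v q) (P (g q))) =ᶠ[𝓝 y]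
      fun q => ∑ d ∈ D, (P (g q)).coeff d * ∏ j, v q j ^ d j := by
    filter_upwards [hg.continuousAt.preimage_mem_nhds (hV.mem_nhds hy)] with q hq
    rw [MvPolynomial.eval_eq']
    refine Finset.sum_subset (hsub _ hq) fun d _ hd => ?_
    rw [MvPolynomial.notMem_support_iff.1 hd, zero_mul]
  refine ContMDiffAt.congr_of_eventuallyEq ?_ heq
  refine ContMDiffAt.sum fun d _ => ContMDiffAt.mul ?_ ?_
  · exact ((hP d).contMDiffAt (hV.mem_nhds hy)).comp y hg
  · refine ContMDiffAt.prod fun j _ => ContMDiffAt.pow ?_ _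
    exact (contMDiffAt_pi_space.1 hv) j

/-- The push-forward of a local section along a morphism over a diffeomorphism of the bases. -/
theorem IsMorphism.isSectionNear_push (hA : A.IsMultiFilteredBundle deg)
    (hA' : A'.IsMultiFilteredBundle deg') {Φ : E → E'} (f : M ≃ₘ⟮𝓡 n, 𝓡 n'⟯ M')
    (hΦ : A.IsMorphism A' Φ f) {x : M} {s : M → E} (hs : A.IsSectionNear x s) :
    A'.IsSectionNear (f x) (fun y => Φ (s (f.symm y))) := by
  obtain ⟨U, hU, hxU, hproj, hsm⟩ := hs
  refine ⟨f.symm ⁻¹' U, hU.preimage f.symm.continuous, by simpa using hxU, fun y hy => ?_,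
    fun c' y hy => ContMDiffAt.contMDiffWithinAt ?_⟩
  · rw [hΦ.proj_comp, hproj _ hy, f.apply_symm_apply]
  · obtain ⟨c, hc⟩ := hA.cover (f.symm y)
    obtain ⟨P, hP, hdeg, heq⟩ := hΦ.polynomial c c'
    set V := A.domain c ∩ f ⁻¹' A'.domain c' with hVdef
    have hV : IsOpen V :=
      (hA.isOpen_domain c).inter ((hA'.isOpen_domain c').preimage f.continuous)
    have hyV : f.symm y ∈ V := ⟨hc, by simpa using hy.2⟩
    rw [contMDiffAt_pi_space]
    intro i
    have key := contMDiffAt_eval (𝓡 n') A.weight hA.weight_ne_zero (A'.weight i) V hV (P i) (hP i)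
      (hdeg i) f.symm (fun y => A.coord c (s (f.symm y))) y hyV f.symm.contMDiff.contMDiffAt
      (((hsm c).contMDiffAt ((hU.inter (hA.isOpen_domain c)).mem_nhds ⟨hy.1, hc⟩)).comp y
        f.symm.contMDiff.contMDiffAt)
    refine key.congr_of_eventuallyEq ?_
    have hnear : f.symm ⁻¹' (U ∩ V) ∈ 𝓝 y :=
      ((hU.inter hV).preimage f.symm.continuous).mem_nhds ⟨hy.1, hyV⟩
    filter_upwards [hnear] with z hz
    have hp : A.proj (s (f.symm z)) = f.symm z := hproj _ hz.1
    rw [heq (s (f.symm z)) (by rw [hp]; exact hz.2) i, hp]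

/-- Contact of order `k` is preserved by composition of smooth maps. -/
theorem iteratedFDeriv_comp_congr {X Y Z : Type*} [NormedAddCommGroup X] [NormedSpace ℝ X]
    [NormedAddCommGroup Y] [NormedSpace ℝ Y] [NormedAddCommGroup Z] [NormedSpace ℝ Z]
    {g h : Y → Z} {u v : X → Y} {x : X} {k : ℕ} (hu : ContDiffAt ℝ ∞ u x) (hv : ContDiffAt ℝ ∞ v x)
    (huv : ∀ q ≤ k, iteratedFDeriv ℝ q u x = iteratedFDeriv ℝ q v x)
    (hg : ContDiffAt ℝ ∞ g (u x)) (hh : ContDiffAt ℝ ∞ h (u x))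
    (hgh : ∀ q ≤ k, iteratedFDeriv ℝ q g (u x) = iteratedFDeriv ℝ q h (u x)) (q : ℕ) (hq : q ≤ k) :
    iteratedFDeriv ℝ q (g ∘ u) x = iteratedFDeriv ℝ q (h ∘ v) x := by
  have h0 : u x = v x := by
    have := congrArg (fun T => T 0) (huv 0 (Nat.zero_le _))
    simpa using this
  have hq' : (q : ℕ∞ω) ≤ ∞ := by exact_mod_cast le_top
  rw [iteratedFDeriv_comp hg hu hq', iteratedFDeriv_comp (h0 ▸ hh) hv hq', ← h0]
  simp only [FormalMultilinearSeries.taylorComp]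
  refine Finset.sum_congr rfl fun c _ => ?_
  have h1 : ftaylorSeries ℝ g (u x) c.length = ftaylorSeries ℝ h (u x) c.length :=
    hgh _ (c.length_le.trans hq)
  have h2 : (fun j => ftaylorSeries ℝ u x (c.partSize j)) =
      fun j => ftaylorSeries ℝ v x (c.partSize j) :=
    funext fun j => huv _ ((c.partSize_le j).trans hq)
  simp only [FormalMultilinearSeries.compAlongOrderedFinpartition, h1]
  rw [h2]

theorem contDiffAt_localRep {x : M} {s : M → E} (hs : A.IsSectionNear x s)
    (hA : A.IsMultiFilteredBundle deg) {χ : OpenPartialHomeomorph M (EuclideanSpace ℝ (Fin n))}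
    (hχ : χ ∈ IsManifold.maximalAtlas (𝓡 n) ∞ M) (hx : x ∈ χ.source) {c : C}
    (hc : x ∈ A.domain c) : ContDiffAt ℝ ∞ (A.localRep χ c s) (χ x) := by
  obtain ⟨U, hU, hxU, -, hsm⟩ := hs
  have h1 : ContMDiffAt (𝓡 n) 𝓘(ℝ, ι → ℝ) ∞ (fun y => A.coord c (s y)) x :=
    (hsm c).contMDiffAt ((hU.inter (hA.isOpen_domain c)).mem_nhds ⟨hxU, hc⟩)
  rw [← contMDiffAt_iff_contDiffAt]
  exact ContMDiffAt.comp (I' := 𝓡 n) (g := fun y => A.coord c (s y)) (χ x)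
    (by rwa [χ.left_inv hx])
    (contMDiffAt_symm_of_mem_maximalAtlas hχ (χ.map_source hx))

/-- Local sections with the same `k`-jet have push-forwards with the same `k`-jet. -/
theorem IsMorphism.sameJet_push [IsManifold (𝓡 n) ∞ M] (hA : A.IsMultiFilteredBundle deg)
    (hA' : A'.IsMultiFilteredBundle deg') {Φ : E → E'} (f : M ≃ₘ⟮𝓡 n, 𝓡 n'⟯ M')
    (hΦ : A.IsMorphism A' Φ f) {x : M} {s t : M → E} (hs : A.IsSectionNear x s)
    (ht : A.IsSectionNear x t) (hst : A.SameJet k x s t) :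
    A'.SameJet k (f x) (fun y => Φ (s (f.symm y))) (fun y => Φ (t (f.symm y))) := by
  intro χ' hχ' c' hx' hc' q hq
  obtain ⟨c, hc⟩ := hA.cover x
  set χ := chartAt (EuclideanSpace ℝ (Fin n)) x with hχdef
  have hχ : χ ∈ IsManifold.maximalAtlas (𝓡 n) ∞ M := IsManifold.chart_mem_maximalAtlas x
  have hx : x ∈ χ.source := mem_chart_source _ x
  obtain ⟨P, hP, hdeg, heq⟩ := hΦ.polynomial c c'
  set V := A.domain c ∩ f ⁻¹' A'.domain c' with hVdef
  have hV : IsOpen V :=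
    (hA.isOpen_domain c).inter ((hA'.isOpen_domain c').preimage f.continuous)
  have hxV : x ∈ V := ⟨hc, hc'⟩
  let G : EuclideanSpace ℝ (Fin n) × (ι → ℝ) → ι' → ℝ := fun zy i =>
    MvPolynomial.eval zy.2 (P i (χ.symm zy.1))
  have hG : ∀ y, ContDiffAt ℝ ∞ G (χ x, y) := by
    intro y
    rw [contDiffAt_pi]
    intro i
    rw [← contMDiffAt_iff_contDiffAt]
    refine contMDiffAt_eval 𝓘(ℝ, EuclideanSpace ℝ (Fin n) × (ι → ℝ)) A.weight hA.weight_ne_zero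
      (A'.weight i) V hV (P i) (hP i) (hdeg i) (fun zy => χ.symm zy.1) (fun zy => zy.2) (χ x, y)
      ?_ ?_ ?_
    · simpa [χ.left_inv hx] using hxV
    · exact ContMDiffAt.comp (χ x, y)
        (contMDiffAt_symm_of_mem_maximalAtlas hχ (χ.map_source hx))
        (contDiff_fst.contMDiff.contMDiffAt)
    · exact contDiff_snd.contMDiff.contMDiffAt
  have hτ : ContDiffAt ℝ ∞ (fun z => χ (f.symm (χ'.symm z))) (χ' (f x)) := by
    rw [← contMDiffAt_iff_contDiffAt]
    have e1 : f.symm (χ'.symm (χ' (f x))) = x := by rw [χ'.left_inv hx', f.symm_apply_apply]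
    refine ContMDiffAt.comp (χ' (f x)) (I' := 𝓡 n) (g := χ)
      (f := fun z => f.symm (χ'.symm z)) ?_ ?_
    · rw [e1]
      exact contMDiffAt_of_mem_maximalAtlas hχ hx
    · exact f.symm.contMDiff.contMDiffAt.comp _
        (contMDiffAt_symm_of_mem_maximalAtlas hχ' (χ'.map_source hx'))
  have hτx : χ (f.symm (χ'.symm (χ' (f x)))) = χ x := by
    rw [χ'.left_inv hx', f.symm_apply_apply]
  have hrep : ∀ s : M → E, A.IsSectionNear x s →
      A'.localRep χ' c' (fun y => Φ (s (f.symm y))) =ᶠ[𝓝 (χ' (f x))]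
        (G ∘ fun z => (z, A.localRep χ c s z)) ∘ fun z => χ (f.symm (χ'.symm z)) := by
    intro s hs
    obtain ⟨U, hU, hxU, hproj, -⟩ := hs
    have hcont : ContinuousAt (fun z => f.symm (χ'.symm z)) (χ' (f x)) :=
      f.symm.continuous.continuousAt.comp
        (χ'.symm.continuousAt (χ'.map_source hx'))
    have hmem : U ∩ V ∩ χ.source ∈ 𝓝 (f.symm (χ'.symm (χ' (f x)))) := by
      rw [χ'.left_inv hx', f.symm_apply_apply]
      exact ((hU.inter hV).inter χ.open_source).mem_nhds ⟨⟨hxU, hxV⟩, hx⟩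
    filter_upwards [hcont.preimage_mem_nhds hmem] with z hz
    obtain ⟨⟨hzU, hzV⟩, hzχ⟩ := hz
    have hp := hproj _ hzU
    funext i
    have h1 := heq (s (f.symm (χ'.symm z))) (by rw [hp]; exact hzV) i
    rw [hp] at h1
    simpa [localRep, G, χ.left_inv hzχ] using h1
  have hgraph : ∀ s : M → E, A.IsSectionNear x s →
      ContDiffAt ℝ ∞ (fun z => (z, A.localRep χ c s z)) (χ x) := fun s hs =>
    contDiffAt_id.prodMk (contDiffAt_localRep hs hA hχ hx hc)
  have hjet : ∀ p ≤ k, iteratedFDeriv ℝ p (fun z => (z, A.localRep χ c s z)) (χ x) =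
      iteratedFDeriv ℝ p (fun z => (z, A.localRep χ c t z)) (χ x) := by
    intro p hp
    have hp' : (p : ℕ∞ω) ≤ ∞ := by exact_mod_cast le_top
    have e1 := iteratedFDeriv_prodMk contDiffAt_id (contDiffAt_localRep hs hA hχ hx hc) hp'
    have e2 := iteratedFDeriv_prodMk contDiffAt_id (contDiffAt_localRep ht hA hχ hx hc) hp'
    rw [hst χ hχ c hx hc p hp] at e1
    exact e1.trans e2.symm
  have hfull : ∀ s : M → E, A.IsSectionNear x s →
      ContDiffAt ℝ ∞ (G ∘ fun z => (z, A.localRep χ c s z)) (χ x) := fun s hs =>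
    (hG _).comp (χ x) (hgraph s hs)
  rw [((hrep s hs).iteratedFDeriv ℝ q).eq_of_nhds, ((hrep t ht).iteratedFDeriv ℝ q).eq_of_nhds]
  refine iteratedFDeriv_comp_congr hτ hτ (fun _ _ => rfl) ?_ ?_ (fun p hp => ?_) q hq
  · rw [hτx]; exact hfull s hs
  · rw [hτx]; exact hfull t ht
  · rw [hτx]
    exact iteratedFDeriv_comp_congr (hgraph s hs) (hgraph t ht) hjet (hG _) (hG _)
      (fun _ _ => rfl) p hp

/-- The `k`-th jet prolongation `J^k Φ : J^k E → J^k E'` of a morphism `Φ` covering a diffeomorphism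
`f` of the bases: `J^k Φ (j^k_x s) = j^k_{f x} (Φ ∘ s ∘ f⁻¹)`. -/
def jetProlongation [IsManifold (𝓡 n) ∞ M] (hA : A.IsMultiFilteredBundle deg)
    (hA' : A'.IsMultiFilteredBundle deg') (Φ : E → E') (f : M ≃ₘ⟮𝓡 n, 𝓡 n'⟯ M')
    (hΦ : A.IsMorphism A' Φ f) (k : ℕ) (p : A.JetSpace k) : A'.JetSpace k :=
  ⟨f p.1, Quotient.map (sa := A.jetSetoid k p.1) (sb := A'.jetSetoid k (f p.1))
    (fun s : A.LocalSection p.1 =>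
      (⟨fun y => Φ (s.1 (f.symm y)), hΦ.isSectionNear_push hA hA' f s.2⟩ :
        A'.LocalSection (f p.1)))
    (fun s t hst => hΦ.sameJet_push hA hA' f s.2 t.2 hst) p.2⟩

end Prolongation

end FibreAtlas

end

/-! ### Combinatorics of multi-indices. -/

noncomputable section

/-! In base coordinates put τ = χ ∘ f⁻¹ ∘ χ'⁻¹. The fibre coordinates of φ ∘ s ∘ f⁻¹ at z are
polynomials in those of s at τ z, with coefficients smooth in z. A partial derivative of such an
expression hits either a coefficient, at no cost in weight, or a jet variable, where the chain rule
turns Y_γ ∘ τ into a combination of the Y_{γ+e_b} ∘ τ with coefficients ∂_a τ^b. The first degree is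
kept and the second rises by at most one, so ∂^β of a coordinate of weight w has bi-degree at most
(w, |β|). The class `IsJetPolynomial` is closed under this operation (`exists_totalDeriv`). It
admits jet variables of every order; the bound |β| ≤ k on the second degree leaves only those of
order at most k (`exists_mvPolynomial`). The resulting formula,
`exists_multiIndexDeriv_localRep_push`, gives the morphism property, and for the identity morphism
it gives the transition maps of the jet bundle.

For local triviality, a jet is determined by its coordinates in one chart: the transition
polynomials yield those in every other chart, and by symmetry of higher derivatives the numbers ∂^β
determine the full iterated derivatives. Every system of coordinates is attained, by a Taylor
polynomial carried to E through a trivialization. The topology is generated by the coordinate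
charts, so the inverse of a chart is continuous because the transition maps are. -/

theorem multiIndex_induction {n : ℕ} {motive : (Fin n → ℕ) → Prop} (zero : motive 0)
    (add_single : ∀ (β : Fin n → ℕ) (a : Fin n), motive β → motive (β + Pi.single a 1))
    (β : Fin n → ℕ) : motive β := by
  obtain ⟨N, hN⟩ : ∃ N, ∑ a, β a = N := ⟨_, rfl⟩
  induction N generalizing β with
  | zero =>
    have : β = 0 := funext fun a => by
      simpa using (Finset.sum_eq_zero_iff.1 hN) a (Finset.mem_univ a)
    exact this ▸ zero
  | succ N ih =>
    obtain ⟨a, -, ha⟩ : ∃ a ∈ Finset.univ, β a ≠ 0 := by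
      by_contra! h
      simp [Finset.sum_eq_zero h] at hN
    have hβ : β = (β - Pi.single a 1) + Pi.single a 1 := by
      funext b
      by_cases hb : b = a
      · subst hb; simp; omega
      · simp [hb]
    rw [hβ]
    refine add_single _ _ (ih _ ?_)
    rw [hβ] at hN
    simp only [Pi.add_apply, Finset.sum_add_distrib, Finset.sum_pi_single', Finset.mem_univ,
      if_true] at hN
    omega

theorem sum_add_piSingle {n : ℕ} (β : Fin n → ℕ) (a : Fin n) :
    ∑ b, (β + Pi.single a 1 : Fin n → ℕ) b = ∑ b, β b + 1 := by
  simp [Finset.sum_add_distrib]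

theorem count_ofFn {α : Type*} [DecidableEq α] {N : ℕ} (g : Fin N → α) (a : α) :
    (List.ofFn g).count a = (Finset.univ.filter fun j => g j = a).card := by
  induction N with
  | zero => simp
  | succ N ih =>
    rw [List.ofFn_succ, List.count_cons, ih, Fin.card_filter_univ_succ]
    simp only [beq_iff_eq]
    split_ifs <;> simp

/-- The enumeration of directions in `multiIndexDeriv` runs through a disjoint union of blocks of
sizes `β a`, so the label `a` has exactly its own block as fibre. -/
theorem card_fiber_finSigmaFinEquiv_symm {n : ℕ} (β : Fin n → ℕ) (a : Fin n) :
    Fintype.card {j : Fin (∑ a, β a) // (finSigmaFinEquiv.symm j).1 = a} = β a := by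
  rw [Fintype.card_congr (finSigmaFinEquiv.symm.subtypeEquiv (q := fun p => p.1 = a)
    fun _ => Iff.rfl), Fintype.card_congr (Equiv.sigmaSubtype a), Fintype.card_fin]

/-- The iterated directional derivative along a list of directions. -/
def listDeriv {E G : Type*} [NormedAddCommGroup E] [NormedSpace ℝ E] [NormedAddCommGroup G]
    [NormedSpace ℝ G] (u : E → G) : List E → E → G
  | [] => u
  | v :: L => fun z => fderiv ℝ (listDeriv u L) z v

/-! ### Iterated directional derivatives and their symmetry. -/

section ListDeriv

variable {E G : Type*} [NormedAddCommGroup E] [NormedSpace ℝ E] [NormedAddCommGroup G]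
  [NormedSpace ℝ G] {u : E → G} {U : Set E}

theorem ContDiffOn.listDeriv (hu : ContDiffOn ℝ ∞ u U) (hU : IsOpen U) (L : List E) :
    ContDiffOn ℝ ∞ (listDeriv u L) U := by
  induction L with
  | nil => exact hu
  | cons v L ih => exact (ih.fderiv_of_isOpen hU (m := ∞) (by simp)).clm_apply contDiffOn_const

/-- Peels off the outermost direction. The inductive identity has to be differentiated, so it is
needed near `z`; this is why an open set is carried along. -/
theorem iteratedFDeriv_eq_listDeriv (hu : ContDiffOn ℝ ∞ u U) (hU : IsOpen U) {N : ℕ}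
    (m : Fin N → E) {z : E} (hz : z ∈ U) :
    iteratedFDeriv ℝ N u z m = _root_.listDeriv u (List.ofFn m) z := by
  induction N generalizing z with
  | zero => simp [_root_.listDeriv]
  | succ N ih =>
    have hd : DifferentiableAt ℝ (iteratedFDeriv ℝ N u) z :=
      ((hu.contDiffAt (hU.mem_nhds hz)).iteratedFDeriv_right (m := 1)
        (by exact_mod_cast le_top)).differentiableAt (by simp)
    have heq : (fun y => iteratedFDeriv ℝ N u y (Fin.tail m)) =ᶠ[𝓝 z]
        _root_.listDeriv u (List.ofFn (Fin.tail m)) := by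
      filter_upwards [hU.mem_nhds hz] with y hy using ih _ hy
    rw [iteratedFDeriv_succ_apply_left, List.ofFn_succ, _root_.listDeriv]
    change _ = fderiv ℝ (_root_.listDeriv u (List.ofFn (Fin.tail m))) z (m 0)
    rw [← heq.fderiv_eq, fderiv_continuousMultilinear_apply_const_apply hd]

/-- Permutations are built from adjacent swaps, and a swap at the head of the list is the symmetry
of the second derivative. Equality on all of `U` lets the `cons` case differentiate both sides. -/
theorem List.Perm.listDeriv_eq (hu : ContDiffOn ℝ ∞ u U) (hU : IsOpen U) {L L' : List E}
    (h : L.Perm L') : Set.EqOn (_root_.listDeriv u L) (_root_.listDeriv u L') U := by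
  induction h with
  | nil => exact fun _ _ => rfl
  | cons v _ ih =>
    intro z hz
    simp only [_root_.listDeriv]
    rw [(ih.eventuallyEq_of_mem (hU.mem_nhds hz)).fderiv_eq]
  | swap v w L =>
    intro z hz
    have hL := (hu.listDeriv hU L).contDiffAt (hU.mem_nhds hz)
    have h2 : (2 : ℕ∞ω) ≤ ∞ := WithTop.coe_le_coe.2 (le_top : ((2 : ℕ) : ℕ∞) ≤ ⊤)
    have hd : DifferentiableAt ℝ (fderiv ℝ (_root_.listDeriv u L)) z :=
      (hL.fderiv_right (m := 1) (by simpa [one_add_one_eq_two] using h2)).differentiableAt (by simp)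
    have hs : IsSymmSndFDerivAt ℝ (_root_.listDeriv u L) z :=
      hL.isSymmSndFDerivAt (by
        simpa using h2)
    simp only [_root_.listDeriv]
    rw [fderiv_clm_apply hd (differentiableAt_const _),
      fderiv_clm_apply hd (differentiableAt_const _)]
    simpa using hs w v
  | trans _ _ ih ih' => exact ih.trans ih'

end ListDeriv

/-! ### Calculus of the multi-index derivatives. -/

section MultiIndexDeriv

variable {n : ℕ} {ι : Type*} [Fintype ι] {u v : EuclideanSpace ℝ (Fin n) → ι → ℝ}
  {U : Set (EuclideanSpace ℝ (Fin n))} {z : EuclideanSpace ℝ (Fin n)}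

/-- An iterated derivative along basis vectors depends only on how often each of them occurs. -/
theorem listDeriv_single_eq_multiIndexDeriv (hu : ContDiffOn ℝ ∞ u U) (hU : IsOpen U) (hz : z ∈ U)
    (L : List (Fin n)) :
    listDeriv u (L.map fun a => EuclideanSpace.single a (1 : ℝ)) z =
      multiIndexDeriv (fun a => L.count a) u z := by
  rw [multiIndexDeriv, iteratedFDeriv_eq_listDeriv hu hU _ hz]
  refine List.Perm.listDeriv_eq hu hU ?_ hz
  have h : (List.ofFn fun j => (finSigmaFinEquiv (n := fun a => L.count a).symm j).1).Perm L := by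
    refine List.perm_iff_count.2 fun a => ?_
    rw [count_ofFn, ← Fintype.card_subtype, card_fiber_finSigmaFinEquiv_symm]
  simpa [List.map_ofFn, Function.comp_def] using
    (h.map fun a => EuclideanSpace.single a (1 : ℝ)).symm

theorem exists_list_count_eq (β : Fin n → ℕ) : ∃ L : List (Fin n), (fun a => L.count a) = β := by
  induction β using multiIndex_induction with
  | zero => exact ⟨[], by ext; simp⟩
  | add_single β a ih =>
    obtain ⟨L, rfl⟩ := ih
    refine ⟨a :: L, funext fun b => ?_⟩
    by_cases h : b = a
    · subst h; simp
    · simp [h, Ne.symm h]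

theorem contDiffOn_multiIndexDeriv (hu : ContDiffOn ℝ ∞ u U) (hU : IsOpen U) (β : Fin n → ℕ) :
    ContDiffOn ℝ ∞ (multiIndexDeriv β u) U := by
  obtain ⟨L, rfl⟩ := exists_list_count_eq β
  exact (hu.listDeriv hU _).congr fun z hz =>
    (listDeriv_single_eq_multiIndexDeriv hu hU hz L).symm

/-- Order is irrelevant, so the additional direction may be put at the head of a list with
multiplicities `β`, where it is the outermost derivative. All later inductions on the order of
differentiation use this recursion. -/
theorem multiIndexDeriv_add_single (hu : ContDiffOn ℝ ∞ u U) (hU : IsOpen U) (hz : z ∈ U)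
    (β : Fin n → ℕ) (a : Fin n) :
    multiIndexDeriv (β + Pi.single a 1) u z =
      fderiv ℝ (multiIndexDeriv β u) z (EuclideanSpace.single a 1) := by
  obtain ⟨L, rfl⟩ := exists_list_count_eq β
  have h : (fun b => L.count b) + Pi.single a 1 = fun b => (a :: L).count b := by
    funext b
    by_cases h : b = a
    · subst h; simp
    · simp [h, Ne.symm h]
  rw [h, ← listDeriv_single_eq_multiIndexDeriv hu hU hz]
  have heq : listDeriv u (L.map fun a => EuclideanSpace.single a (1 : ℝ)) =ᶠ[𝓝 z]
      multiIndexDeriv (fun a => L.count a) u := by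
    filter_upwards [hU.mem_nhds hz] with y hy
      using listDeriv_single_eq_multiIndexDeriv hu hU hy L
  rw [← heq.fderiv_eq]
  rfl

theorem multiIndexDeriv_zero : multiIndexDeriv (0 : Fin n → ℕ) u z = u z := by
  -- The order is a sum of zeros, equal to `0` only propositionally; it is generalised so that it
  -- can be substituted.
  have h : ∀ (N : ℕ) (m : Fin N → EuclideanSpace ℝ (Fin n)), N = 0 →
      iteratedFDeriv ℝ N u z m = u z := by
    rintro N m rfl
    rfl
  exact h _ _ (by simp)

theorem Filter.EventuallyEq.multiIndexDeriv_eq (h : u =ᶠ[𝓝 z] v) (β : Fin n → ℕ) :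
    multiIndexDeriv β u z = multiIndexDeriv β v z := by
  rw [multiIndexDeriv, multiIndexDeriv, (h.iteratedFDeriv ℝ _).eq_of_nhds]

/-- All derivatives of order at most `k` are determined by the multi-index derivatives. -/
theorem iteratedFDeriv_eq_of_multiIndexDeriv_eq {V : Set (EuclideanSpace ℝ (Fin n))}
    (hu : ContDiffOn ℝ ∞ u U) (hU : IsOpen U) (hzU : z ∈ U) (hv : ContDiffOn ℝ ∞ v V)
    (hV : IsOpen V) (hzV : z ∈ V) {q : ℕ}
    (h : ∀ β : Fin n → ℕ, ∑ a, β a = q → multiIndexDeriv β u z = multiIndexDeriv β v z) :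
    iteratedFDeriv ℝ q u z = iteratedFDeriv ℝ q v z := by
  -- A multilinear map is determined by its values on tuples of basis vectors, and each tuple gives
  -- the multi-index, of order `q`, that counts its entries.
  refine ContinuousMultilinearMap.toMultilinearMap_injective
    (Module.Basis.ext_multilinear (fun _ => (EuclideanSpace.basisFun (Fin n) ℝ).toBasis)
    fun g => ?_)
  have hg : ∑ a, (List.ofFn g).count a = q := by
    simp only [count_ofFn]
    simpa using (Finset.card_eq_sum_card_fiberwise (s := Finset.univ) (t := Finset.univ) (f := g)
      fun _ _ => Finset.mem_coe.2 (Finset.mem_univ _)).symm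
  have := h _ hg
  rw [← listDeriv_single_eq_multiIndexDeriv hu hU hzU,
    ← listDeriv_single_eq_multiIndexDeriv hv hV hzV] at this
  simpa [iteratedFDeriv_eq_listDeriv hu hU _ hzU, iteratedFDeriv_eq_listDeriv hv hV _ hzV,
    List.map_ofFn, Function.comp_def] using this

end MultiIndexDeriv

instance multiIndexLE_finite (n k : ℕ) : Finite (MultiIndexLE n k) :=
  Finite.of_injective (β := Fin n → Fin (k + 1))
    (fun β a => ⟨β.1 a, Nat.lt_succ_of_le
      ((Finset.single_le_sum (fun _ _ => Nat.zero_le _) (Finset.mem_univ a)).trans β.2)⟩)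
    fun β γ h => Subtype.ext (funext fun a => by simpa using congrFun h a)

instance multiIndexLE_fintype (n k : ℕ) : Fintype (MultiIndexLE n k) := Fintype.ofFinite _

/-! ### Polynomial maps with prescribed derivatives at a point. -/

section PolynomialSections

variable {n k : ℕ} {ι : Type*}

/-- The `β`-th partial derivative of the polynomial map
`z ↦ ∑ γ, y (j, γ) (z - x₀) ^ γ`. -/
def taylorDeriv (y : ι × MultiIndexLE n k → ℝ) (x₀ : EuclideanSpace ℝ (Fin n)) (β : Fin n → ℕ)
    (z : EuclideanSpace ℝ (Fin n)) (j : ι) : ℝ :=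
  ∑ γ : MultiIndexLE n k, y (j, γ) *
    ∏ a, ((γ.1 a).descFactorial (β a) : ℝ) * (z a - x₀ a) ^ (γ.1 a - β a)

variable (y : ι × MultiIndexLE n k → ℝ) (x₀ z : EuclideanSpace ℝ (Fin n)) (β : Fin n → ℕ)

/-- Only `γ = β` survives at the centre: if some `γ a < β a`, the descending factorial vanishes, and
if some `γ a > β a`, a positive power of zero remains. -/
theorem taylorDeriv_self (β : MultiIndexLE n k) (j : ι) :
    taylorDeriv y x₀ β.1 x₀ j = y (j, β) * ∏ a, ((β.1 a).factorial : ℝ) := by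
  rw [taylorDeriv, Finset.sum_eq_single β]
  · simp [Nat.descFactorial_self]
  · intro γ _ hγ
    obtain ⟨a, ha⟩ : ∃ a, γ.1 a ≠ β.1 a := by
      by_contra! h
      exact hγ (Subtype.ext (funext h))
    rw [Finset.prod_eq_zero (Finset.mem_univ a), mul_zero]
    rcases lt_or_gt_of_ne ha with h | h
    · simp [Nat.descFactorial_eq_zero_iff_lt.2 h]
    · simp [Nat.sub_ne_zero_of_lt h]
  · simp

variable [Fintype ι]

theorem contDiff_taylorDeriv : ContDiff ℝ ∞ (taylorDeriv y x₀ β) := by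
  rw [contDiff_pi]
  intro j
  refine ContDiff.sum fun γ _ => contDiff_const.mul (contDiff_prod fun a _ => ?_)
  have h : ContDiff ℝ ∞ fun z : EuclideanSpace ℝ (Fin n) => z a :=
    (EuclideanSpace.proj (𝕜 := ℝ) a).contDiff
  exact contDiff_const.mul ((h.sub contDiff_const).pow _)

/-- Truncated subtraction is harmless: for `g ≤ b` the power is constant, and the new descending
factorial contains the factor `g - b = 0`. -/
theorem hasDerivAt_descFactorial_mul_pow (g b : ℕ) (c t : ℝ) :
    HasDerivAt (fun t : ℝ => (g.descFactorial b : ℝ) * (t - c) ^ (g - b))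
      ((g.descFactorial (b + 1) : ℝ) * (t - c) ^ (g - (b + 1))) t := by
  refine ((((hasDerivAt_id t).sub_const c).pow (g - b)).const_mul
    (g.descFactorial b : ℝ)).congr_deriv ?_
  rw [Nat.descFactorial_succ, Nat.sub_sub]
  simp
  ring

theorem fderiv_taylorDeriv_single (a : Fin n) :
    fderiv ℝ (taylorDeriv y x₀ β) z (EuclideanSpace.single a 1) =
      taylorDeriv y x₀ (β + Pi.single a 1) z := by
  funext j
  have hfac : ∀ (γ : MultiIndexLE n k) (b : Fin n), HasFDerivAt
      (fun z : EuclideanSpace ℝ (Fin n) =>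
        ((γ.1 b).descFactorial (β b) : ℝ) * (z b - x₀ b) ^ (γ.1 b - β b))
      ((((γ.1 b).descFactorial (β b + 1) : ℝ) * (z b - x₀ b) ^ (γ.1 b - (β b + 1))) •
        (EuclideanSpace.proj (𝕜 := ℝ) b : EuclideanSpace ℝ (Fin n) →L[ℝ] ℝ)) z := fun γ b =>
    (hasDerivAt_descFactorial_mul_pow (γ.1 b) (β b) (x₀ b) (z b)).comp_hasFDerivAt
      (f := fun z : EuclideanSpace ℝ (Fin n) => z b) z (EuclideanSpace.proj (𝕜 := ℝ) b).hasFDerivAt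
  have hsum := HasFDerivAt.fun_sum (u := Finset.univ) fun (γ : MultiIndexLE n k) _ =>
    (HasFDerivAt.finsetProd (u := Finset.univ) fun b _ => hfac γ b).const_mul (y (j, γ))
  have hj := fderiv_apply ((contDiff_taylorDeriv y x₀ β).differentiable (by simp) z) j
  have := congrArg (fun T => T (EuclideanSpace.single a 1)) (hsum.fderiv.symm.trans hj)
  refine this.symm.trans ?_
  simp only [sum_apply, smul_apply, taylorDeriv]
  refine Finset.sum_congr rfl fun γ _ => ?_
  -- In the product rule only the factor in the variable `z a` has a non-zero derivative along
  -- `e_a`.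
  rw [smul_eq_mul, Finset.sum_eq_single a]
  · rw [← Finset.prod_erase_mul _ _ (Finset.mem_univ a)]
    have h : ∀ b ∈ Finset.univ.erase a, (β + Pi.single a 1 : Fin n → ℕ) b = β b := fun b hb => by
      simp [Finset.ne_of_mem_erase hb]
    have hpr : ∏ b ∈ Finset.univ.erase a,
        ((γ.1 b).descFactorial ((β + Pi.single a 1 : Fin n → ℕ) b) : ℝ) *
          (z b - x₀ b) ^ (γ.1 b - (β + Pi.single a 1 : Fin n → ℕ) b) =
        ∏ b ∈ Finset.univ.erase a,
          ((γ.1 b).descFactorial (β b) : ℝ) * (z b - x₀ b) ^ (γ.1 b - β b) :=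
      Finset.prod_congr rfl fun b hb => by rw [h b hb]
    have ha : (β + Pi.single a 1 : Fin n → ℕ) a = β a + 1 := by simp
    rw [hpr, ha]
    simp
  · intro b _ hb
    simp [hb]
  · simp

theorem multiIndexDeriv_taylorDeriv_zero :
    multiIndexDeriv β (taylorDeriv y x₀ 0) = taylorDeriv y x₀ β := by
  induction β using multiIndex_induction with
  | zero => exact funext fun z => multiIndexDeriv_zero
  | add_single β a ih =>
    funext z
    rw [multiIndexDeriv_add_single (contDiff_taylorDeriv y x₀ 0).contDiffOn isOpen_univ
      (Set.mem_univ z), ih, fderiv_taylorDeriv_single]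

/-- Every system of values is the system of derivatives of some smooth map. -/
theorem exists_contDiff_multiIndexDeriv_eq : ∃ u : EuclideanSpace ℝ (Fin n) → ι → ℝ,
    ContDiff ℝ ∞ u ∧ ∀ j (β : MultiIndexLE n k), multiIndexDeriv β.1 u x₀ j = y (j, β) := by
  -- Dividing by β! cancels the factorials that appear in `taylorDeriv_self`.
  refine ⟨taylorDeriv (fun jβ => y jβ / ∏ a, ((jβ.2.1 a).factorial : ℝ)) x₀ 0,
    contDiff_taylorDeriv _ _ _, fun j β => ?_⟩
  rw [multiIndexDeriv_taylorDeriv_zero, taylorDeriv_self, div_mul_cancel₀]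
  exact Finset.prod_ne_zero_iff.2 fun a _ => Nat.cast_ne_zero.2 (Nat.factorial_ne_zero _)

end PolynomialSections

/-! ### Differential polynomials with two degrees. -/

section JetPolynomials

variable {n n' k : ℕ} {ι ι' : Type*}

/-- The class of functions `Q z Y` that are polynomial in the jet variables `Y (j, γ)`, with
coefficients smooth in `z ∈ V`, of weighted degree at most `p` when `Y (j, γ)` has weight `w j`,
and at most `q` when it has weight `|γ|`. -/
inductive IsJetPolynomial (w : ι → ℕ) (V : Set (EuclideanSpace ℝ (Fin n'))) :
    ℕ → ℕ → (EuclideanSpace ℝ (Fin n') → (ι × (Fin n → ℕ) → ℝ) → ℝ) → Prop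
  | coeff {c : EuclideanSpace ℝ (Fin n') → ℝ} (hc : ContDiffOn ℝ ∞ c V) :
      IsJetPolynomial w V 0 0 fun z _ => c z
  | coord (j : ι) (γ : Fin n → ℕ) :
      IsJetPolynomial w V (w j) (∑ a, γ a) fun _ Y => Y (j, γ)
  | add {p q Q R} (hQ : IsJetPolynomial w V p q Q) (hR : IsJetPolynomial w V p q R) :
      IsJetPolynomial w V p q fun z Y => Q z Y + R z Y
  | mul {p q p' q' Q R} (hQ : IsJetPolynomial w V p q Q) (hR : IsJetPolynomial w V p' q' R) :
      IsJetPolynomial w V (p + p') (q + q') fun z Y => Q z Y * R z Y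
  | mono {p q p' q' Q} (hp : p ≤ p') (hq : q ≤ q') (hQ : IsJetPolynomial w V p q Q) :
      IsJetPolynomial w V p' q' Q

namespace IsJetPolynomial

variable {w : ι → ℕ} {V : Set (EuclideanSpace ℝ (Fin n'))} {p q p' q' : ℕ}
  {Q : EuclideanSpace ℝ (Fin n') → (ι × (Fin n → ℕ) → ℝ) → ℝ}

theorem sum {T : Type*} (S : Finset T)
    {Q : T → EuclideanSpace ℝ (Fin n') → (ι × (Fin n → ℕ) → ℝ) → ℝ}
    (hQ : ∀ t ∈ S, IsJetPolynomial w V p q (Q t)) :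
    IsJetPolynomial w V p q fun z Y => ∑ t ∈ S, Q t z Y := by
  classical
  induction S using Finset.induction_on with
  | empty =>
    simpa using mono (Nat.zero_le p) (Nat.zero_le q) (coeff (w := w) (n := n) (V := V)
      (contDiffOn_const (c := (0 : ℝ))))
  | insert t S ht ih =>
    simp only [Finset.sum_insert ht]
    exact add (hQ t (by simp)) (ih fun s hs => hQ s (by simp [hs]))

theorem pow (hQ : IsJetPolynomial w V p q Q) (m : ℕ) :
    IsJetPolynomial w V (m * p) (m * q) fun z Y => Q z Y ^ m := by
  induction m with
  | zero =>
    simpa using coeff (w := w) (n := n) (V := V) (contDiffOn_const (c := (1 : ℝ)))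
  | succ m ih =>
    simp only [pow_succ, Nat.succ_mul]
    exact mul ih hQ

theorem prod {T : Type*} (S : Finset T) {p q : T → ℕ}
    {Q : T → EuclideanSpace ℝ (Fin n') → (ι × (Fin n → ℕ) → ℝ) → ℝ}
    (hQ : ∀ t ∈ S, IsJetPolynomial w V (p t) (q t) (Q t)) :
    IsJetPolynomial w V (∑ t ∈ S, p t) (∑ t ∈ S, q t) fun z Y => ∏ t ∈ S, Q t z Y := by
  classical
  induction S using Finset.induction_on with
  | empty =>
    simpa using coeff (w := w) (n := n) (V := V) (contDiffOn_const (c := (1 : ℝ)))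
  | insert t S ht ih =>
    simp only [Finset.prod_insert ht, Finset.sum_insert ht]
    exact mul (hQ t (by simp)) (ih fun s hs => hQ s (by simp [hs]))

/-- Jet polynomials of second degree at most `k` are polynomials in the jet variables of order at
most `k`. -/
theorem exists_mvPolynomial (hQ : IsJetPolynomial w V p q Q) (hqk : q ≤ k) :
    ∃ P : EuclideanSpace ℝ (Fin n') → MvPolynomial (ι × MultiIndexLE n k) ℝ,
      (∀ d, ContDiffOn ℝ ∞ (fun z => (P z).coeff d) V) ∧
      (∀ z, ∀ d ∈ (P z).support, Finsupp.weight (fun jγ => w jγ.1) d ≤ p ∧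
        Finsupp.weight (fun jγ : ι × MultiIndexLE n k => ∑ a, jγ.2.1 a) d ≤ q) ∧
      ∀ z Y, Q z Y = MvPolynomial.eval (fun jγ => Y (jγ.1, jγ.2.1)) (P z) := by
  classical
  induction hQ with
  | @coeff c hc =>
    refine ⟨fun z => MvPolynomial.C (c z), fun d => ?_, fun z d hd => ?_, fun z Y => by simp⟩
    · simp only [MvPolynomial.coeff_C]
      split_ifs
      exacts [hc, contDiffOn_const]
    · have : d = 0 := by
        by_contra h
        simp [MvPolynomial.coeff_C, Ne.symm h] at hd
      simp [this]
  | coord j γ =>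
    -- The second degree of this variable is |γ|, so `hqk` is exactly the condition for `γ` to be a
    -- multi-index of order at most `k`.
    refine ⟨fun _ => MvPolynomial.X (j, ⟨γ, hqk⟩), fun d => contDiffOn_const, fun z d hd => ?_,
      fun z Y => by simp⟩
    rw [MvPolynomial.support_X, Finset.mem_singleton] at hd
    simp [hd, Finsupp.weight_single]
  | add _ _ ihQ ihR =>
    obtain ⟨P, hP, hdP, heP⟩ := ihQ hqk
    obtain ⟨P', hP', hdP', heP'⟩ := ihR hqk
    refine ⟨fun z => P z + P' z, fun d => ?_, fun z d hd => ?_, fun z Y => ?_⟩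
    · simp only [MvPolynomial.coeff_add]
      exact (hP d).add (hP' d)
    · exact (Finset.mem_union.1 (MvPolynomial.support_add hd)).elim (hdP z d) (hdP' z d)
    · simp only [heP, heP', map_add]
  | mul _ _ ihQ ihR =>
    obtain ⟨P, hP, hdP, heP⟩ := ihQ (by omega)
    obtain ⟨P', hP', hdP', heP'⟩ := ihR (by omega)
    refine ⟨fun z => P z * P' z, fun d => ?_, fun z d hd => ?_, fun z Y => ?_⟩
    · simp only [MvPolynomial.coeff_mul]
      exact ContDiffOn.sum fun e _ => (hP e.1).mul (hP' e.2)
    · obtain ⟨e, he, e', he', rfl⟩ := Finset.mem_add.1 (MvPolynomial.support_mul _ _ hd)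
      rw [map_add, map_add]
      exact ⟨add_le_add (hdP z e he).1 (hdP' z e' he').1,
        add_le_add (hdP z e he).2 (hdP' z e' he').2⟩
    · simp only [heP, heP', map_mul]
  | mono hp hq _ ih =>
    obtain ⟨P, hP, hdP, heP⟩ := ih (hq.trans hqk)
    exact ⟨P, hP, fun z d hd => ⟨(hdP z d hd).1.trans hp, (hdP z d hd).2.trans hq⟩, heP⟩

variable [Fintype ι]

/-- Substituting the derivatives of a smooth map `u` along `τ` in a jet polynomial gives a smooth
function, and differentiation of the latter is given by a jet polynomial of higher second
degree. -/
theorem exists_totalDeriv (hQ : IsJetPolynomial w V p q Q) (hV : IsOpen V)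
    {τ : EuclideanSpace ℝ (Fin n') → EuclideanSpace ℝ (Fin n)} (hτ : ContDiffOn ℝ ∞ τ V)
    (a : Fin n') :
    ∃ Q', IsJetPolynomial w V p (q + 1) Q' ∧ ∀ (u : EuclideanSpace ℝ (Fin n) → ι → ℝ) U,
      IsOpen U → ContDiffOn ℝ ∞ u U → ∀ z ∈ V, τ z ∈ U →
        ContDiffAt ℝ ∞ (fun z => Q z fun jγ => multiIndexDeriv jγ.2 u (τ z) jγ.1) z ∧
        fderiv ℝ (fun z => Q z fun jγ => multiIndexDeriv jγ.2 u (τ z) jγ.1) z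
          (EuclideanSpace.single a 1) = Q' z fun jγ => multiIndexDeriv jγ.2 u (τ z) jγ.1 := by
  induction hQ with
  | @coeff c hc =>
    refine ⟨fun z _ => fderiv ℝ c z (EuclideanSpace.single a 1), mono le_rfl (Nat.zero_le _)
      (coeff ((hc.fderiv_of_isOpen hV (m := ∞) (by simp)).clm_apply contDiffOn_const)),
      fun u U _ _ z hz _ => ⟨hc.contDiffAt (hV.mem_nhds hz), rfl⟩⟩
  | coord j γ =>
    -- Chain rule: ∂_a (Y_γ ∘ τ) = ∑_b ∂_a τ^b · (Y_{γ+e_b} ∘ τ), of unchanged first degree and of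
    -- second degree |γ| + 1.
    refine ⟨fun z Y => ∑ b, fderiv ℝ τ z (EuclideanSpace.single a 1) b *
      Y (j, γ + Pi.single b 1), sum _ fun b _ => ?_, fun u U hU hu z hz hzU => ?_⟩
    · have h1 : ContDiffOn ℝ ∞ (fun z => fderiv ℝ τ z (EuclideanSpace.single a 1) b) V :=
        (EuclideanSpace.proj (𝕜 := ℝ) b).contDiff.comp_contDiffOn
          ((hτ.fderiv_of_isOpen hV (m := ∞) (by simp)).clm_apply contDiffOn_const)
      have h2 := mul (coeff (w := w) h1) (coord (V := V) (w := w) j (γ + Pi.single b 1))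
      rw [sum_add_piSingle] at h2
      simpa using h2
    · have h1 := (contDiffOn_multiIndexDeriv hu hU γ).contDiffAt (hU.mem_nhds hzU)
      have h2 := hτ.contDiffAt (hV.mem_nhds hz)
      have h3 : ContDiffAt ℝ ∞ (fun z => multiIndexDeriv γ u (τ z)) z := h1.comp z h2
      refine ⟨contDiffAt_pi.1 h3 j, ?_⟩
      dsimp only
      rw [fderiv_apply (h3.differentiableAt (by simp)) j]
      have h4 : fderiv ℝ (fun z => multiIndexDeriv γ u (τ z)) z = _ :=
        fderiv_comp z (h1.differentiableAt (by simp)) (h2.differentiableAt (by simp))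
      rw [h4]
      simp only [multiIndexDeriv_add_single hu hU hzU]
      change fderiv ℝ (multiIndexDeriv γ u) (τ z) (fderiv ℝ τ z (EuclideanSpace.single a 1)) j = _
      generalize fderiv ℝ τ z (EuclideanSpace.single a 1) = v
      conv_lhs => rw [← (EuclideanSpace.basisFun (Fin n) ℝ).sum_repr v]
      simp [map_sum]
  | @add p q Q R _ _ ihQ ihR =>
    obtain ⟨Q', hQ', hQu⟩ := ihQ
    obtain ⟨R', hR', hRu⟩ := ihR
    refine ⟨_, add hQ' hR', fun u U hU hu z hz hzU => ?_⟩
    obtain ⟨h1, h2⟩ := hQu u U hU hu z hz hzU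
    obtain ⟨h3, h4⟩ := hRu u U hU hu z hz hzU
    refine ⟨h1.add h3, ?_⟩
    rw [← h2, ← h4, fderiv_fun_add (h1.differentiableAt (by simp)) (h3.differentiableAt (by simp))]
    rfl
  | @mul p q p' q' Q R hQ hR ihQ ihR =>
    obtain ⟨Q', hQ', hQu⟩ := ihQ
    obtain ⟨R', hR', hRu⟩ := ihR
    refine ⟨_, add (mono le_rfl (by omega) (mul hQ hR')) (mono le_rfl (by omega) (mul hQ' hR)),
      fun u U hU hu z hz hzU => ?_⟩
    obtain ⟨h1, h2⟩ := hQu u U hU hu z hz hzU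
    obtain ⟨h3, h4⟩ := hRu u U hU hu z hz hzU
    refine ⟨h1.mul h3, ?_⟩
    rw [← h2, ← h4, fderiv_fun_mul (h1.differentiableAt (by simp)) (h3.differentiableAt (by simp))]
    simp [mul_comm]
  | mono hp hq _ ih =>
    obtain ⟨Q', hQ', hQu⟩ := ih
    exact ⟨Q', mono hp (by omega) hQ', hQu⟩

/-- The higher derivatives of a jet polynomial are jet polynomials. -/
theorem exists_multiIndexDeriv [Fintype ι'] {p : ι' → ℕ}
    {Q : ι' → EuclideanSpace ℝ (Fin n') → (ι × (Fin n → ℕ) → ℝ) → ℝ}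
    (hQ : ∀ i, IsJetPolynomial w V (p i) 0 (Q i)) (hV : IsOpen V)
    {τ : EuclideanSpace ℝ (Fin n') → EuclideanSpace ℝ (Fin n)} (hτ : ContDiffOn ℝ ∞ τ V)
    (β : Fin n' → ℕ) :
    ∃ Q' : ι' → EuclideanSpace ℝ (Fin n') → (ι × (Fin n → ℕ) → ℝ) → ℝ,
      (∀ i, IsJetPolynomial w V (p i) (∑ a, β a) (Q' i)) ∧
      ∀ (u : EuclideanSpace ℝ (Fin n) → ι → ℝ) U, IsOpen U → ContDiffOn ℝ ∞ u U →
        ∀ z ∈ V, τ z ∈ U → ∀ i,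
          multiIndexDeriv β (fun z i => Q i z fun jγ => multiIndexDeriv jγ.2 u (τ z) jγ.1) z i =
            Q' i z fun jγ => multiIndexDeriv jγ.2 u (τ z) jγ.1 := by
  induction β using multiIndex_induction with
  | zero => exact ⟨Q, by simpa using hQ, fun u U _ _ z _ _ i => by rw [multiIndexDeriv_zero]⟩
  | add_single β a ih =>
    obtain ⟨Q', hQ', hQu⟩ := ih
    -- The new polynomials are chosen before `u`, hence serve all sections at once.
    choose Q'' hQ'' hQu' using fun i => (hQ' i).exists_totalDeriv hV hτ a
    refine ⟨Q'', fun i => by rw [sum_add_piSingle]; exact hQ'' i, fun u U hU hu z hz hzU i => ?_⟩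
    -- On this open set τ stays where `u` is smooth, so the inductive formula holds near `z` and can
    -- be differentiated.
    have hW : IsOpen (V ∩ τ ⁻¹' U) := hτ.continuousOn.isOpen_inter_preimage hV hU
    have hg : ContDiffOn ℝ ∞
        (fun z i => Q i z fun jγ => multiIndexDeriv jγ.2 u (τ z) jγ.1) (V ∩ τ ⁻¹' U) :=
      fun y hy => (contDiffAt_pi.2 fun i =>
        (((hQ i).exists_totalDeriv hV hτ a).choose_spec.2 u U hU hu y hy.1 hy.2).1).contDiffWithinAt
    have heq : multiIndexDeriv β (fun z i => Q i z fun jγ => multiIndexDeriv jγ.2 u (τ z) jγ.1)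
        =ᶠ[𝓝 z] fun z i => Q' i z fun jγ => multiIndexDeriv jγ.2 u (τ z) jγ.1 := by
      filter_upwards [hW.mem_nhds ⟨hz, hzU⟩] with y hy
      exact funext fun i => hQu u U hU hu y hy.1 hy.2 i
    rw [multiIndexDeriv_add_single hg hW ⟨hz, hzU⟩, heq.fderiv_eq,
      ← (hQu' i u U hU hu z hz hzU).2,
      fderiv_apply (Φ := fun z i => Q' i z fun jγ => multiIndexDeriv jγ.2 u (τ z) jγ.1)
        (differentiableAt_pi.2 fun i =>
          (hQu' i u U hU hu z hz hzU).1.differentiableAt (by simp)) i]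
    rfl

end IsJetPolynomial

end JetPolynomials

namespace FibreAtlas

/-! ### Jet coordinates of push-forwards. -/

section JetFormula

variable {n n' r k l m : ℕ} {M M' E E' C C' ι ι' : Type*}
  [TopologicalSpace M] [ChartedSpace (EuclideanSpace ℝ (Fin n)) M]
  [TopologicalSpace M'] [ChartedSpace (EuclideanSpace ℝ (Fin n')) M']

/-- Makes changes of jet coordinates a special case of the prolongation of morphisms. -/
theorem IsMultiFilteredBundle.isMorphism_refl [TopologicalSpace E]
    {A : FibreAtlas n r M E C ι} {deg : Fin r → ℕ}
    (hA : A.IsMultiFilteredBundle deg) : A.IsMorphism A id (Diffeomorph.refl (𝓡 n) M ∞) where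
  smooth_base := contMDiff_id
  proj_comp _ := rfl
  polynomial := hA.transition

variable [Fintype ι] [Fintype ι']

/-- The local representative of a section is smooth on an open set. -/
theorem IsSectionNear.exists_contDiffOn_localRep [TopologicalSpace E]
    {A : FibreAtlas n r M E C ι} {deg : Fin r → ℕ}
    (hA : A.IsMultiFilteredBundle deg) {x : M} {s : M → E} (hs : A.IsSectionNear x s)
    {χ : OpenPartialHomeomorph M (EuclideanSpace ℝ (Fin n))}
    (hχ : χ ∈ IsManifold.maximalAtlas (𝓡 n) ∞ M) (hx : x ∈ χ.source) {c : C}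
    (hc : x ∈ A.domain c) :
    ∃ U : Set (EuclideanSpace ℝ (Fin n)), IsOpen U ∧ χ x ∈ U ∧ U ⊆ χ.target ∧
      (∀ z ∈ U, A.proj (s (χ.symm z)) = χ.symm z) ∧ ContDiffOn ℝ ∞ (A.localRep χ c s) U := by
  obtain ⟨W, hW, hxW, hproj, hsm⟩ := hs
  have hWc := hW.inter (hA.isOpen_domain c)
  refine ⟨χ.target ∩ χ.symm ⁻¹' (W ∩ A.domain c), χ.isOpen_inter_preimage_symm hWc,
    ⟨χ.map_source hx, by simpa [χ.left_inv hx] using ⟨hxW, hc⟩⟩, Set.inter_subset_left,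
    fun z hz => hproj _ hz.2.1, fun z hz => ContDiffAt.contDiffWithinAt ?_⟩
  rw [← contMDiffAt_iff_contDiffAt]
  exact ContMDiffAt.comp (I' := 𝓡 n) (g := fun y => A.coord c (s y)) z
    ((hsm c).contMDiffAt (hWc.mem_nhds hz.2)) (contMDiffAt_symm_of_mem_maximalAtlas hχ hz.1)

/-- A weighted polynomial of bounded degree, with smooth coefficients, as a jet polynomial of
order zero. -/
theorem exists_isJetPolynomial_eval (w : ι → ℕ) (hw : ∀ j, w j ≠ 0) (d₀ : ℕ)
    (V : Set (EuclideanSpace ℝ (Fin n'))) (P : EuclideanSpace ℝ (Fin n') → MvPolynomial ι ℝ)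
    (hP : ∀ d, ContDiffOn ℝ ∞ (fun z => (P z).coeff d) V)
    (hdeg : ∀ z ∈ V, (P z).weightedTotalDegree w ≤ d₀) :
    ∃ Q, IsJetPolynomial (n := n) w V d₀ 0 Q ∧
      ∀ z ∈ V, ∀ Y, Q z Y = MvPolynomial.eval (fun j => Y (j, 0)) (P z) := by
  classical
  -- Since the weights are non-zero, each exponent is bounded by the weighted degree. Thus one
  -- finite set of monomials serves for all `z ∈ V`.
  set S : Finset (ι →₀ ℕ) :=
    {d ∈ Finset.Iic (Finsupp.equivFunOnFinite.symm fun _ => d₀) | Finsupp.weight w d ≤ d₀} with hS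
  refine ⟨fun z Y => ∑ d ∈ S, (P z).coeff d * ∏ j, Y (j, 0) ^ d j,
    IsJetPolynomial.sum S fun d hd => ?_, fun z hz Y => ?_⟩
  · have h := (IsJetPolynomial.coeff (n := n) (w := w) (hP d)).mul
      (IsJetPolynomial.prod Finset.univ fun j _ =>
        (IsJetPolynomial.coord (V := V) (w := w) j 0).pow (d j))
    refine h.mono ?_ (by simp)
    have hd' := (Finset.mem_filter.1 hd).2
    rw [Finsupp.weight_apply, Finsupp.sum_fintype _ _ (by simp)] at hd'
    simpa using hd'
  · rw [MvPolynomial.eval_eq']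
    refine (Finset.sum_subset (fun d hd => ?_) fun d _ hd => ?_).symm
    · have h := (MvPolynomial.le_weightedTotalDegree w hd).trans (hdeg z hz)
      refine Finset.mem_filter.2 ⟨Finset.mem_Iic.2 fun j => ?_, h⟩
      simpa using (Finsupp.le_weight w (hw j) d).trans h
    · rw [MvPolynomial.notMem_support_iff.1 hd, zero_mul]

variable {A : FibreAtlas n 1 M E C ι} {A' : FibreAtlas n' 1 M' E' C' ι'}

theorem jetAtlas_weightedTotalDegree_le {P : MvPolynomial (ι × MultiIndexLE n k) ℝ} {p q : ℕ}
    (h : ∀ d ∈ P.support, Finsupp.weight (fun jγ => A.weight jγ.1 0) d ≤ p ∧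
      Finsupp.weight (fun jγ : ι × MultiIndexLE n k => ∑ a, jγ.2.1 a) d ≤ q) (a : Fin 2) :
    P.weightedTotalDegree (fun j => (A.jetAtlas k).weight j a) ≤ (![p, q] : Fin 2 → ℕ) a := by
  refine Finset.sup_le fun d hd => ?_
  fin_cases a
  exacts [(h d hd).1, (h d hd).2]

/-- The jet coordinates of the jet of a section. -/
theorem jetCoord_jet {x : M} (s : A.LocalSection x) {χc : IsManifold.maximalAtlas (𝓡 n) ∞ M × C}
    (hx : x ∈ (A.jetAtlas k).domain χc) (iβ : ι × MultiIndexLE n k) :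
    (A.jetAtlas k).coord χc (A.jet k x s) iβ =
      multiIndexDeriv iβ.2.1 (A.localRep χc.1.1 χc.2 s.1) (χc.1.1 x) iβ.1 := by
  have h : (A.jet k x s).1 ∈ χc.1.1.source ∩ A.domain χc.2 := hx
  simp only [jetAtlas, jetCoord, dif_pos h]
  rfl

theorem exists_eq_jet (p : A.JetSpace k) : ∃ x, ∃ s : A.LocalSection x, p = A.jet k x s := by
  obtain ⟨x, q⟩ := p
  induction q using Quotient.inductionOn with
  | h s => exact ⟨x, s, rfl⟩

variable [TopologicalSpace E] [TopologicalSpace E']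

theorem isOpen_jetAtlas_domain (hA : A.IsFilteredBundle l)
    (χc : IsManifold.maximalAtlas (𝓡 n) ∞ M × C) : IsOpen ((A.jetAtlas k).domain χc) :=
  χc.1.1.open_source.inter (hA.isOpen_domain χc.2)

/-- The jet coordinates of the push-forward of a section along a morphism of filtered bundles are
polynomials in the jet coordinates of the section, with smooth coefficients, and of bounded
bi-degree. -/
theorem IsMorphism.exists_multiIndexDeriv_localRep_push (hA : A.IsFilteredBundle l)
    (hA' : A'.IsFilteredBundle m) {Φ : E → E'} (f : M ≃ₘ⟮𝓡 n, 𝓡 n'⟯ M')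
    (hΦ : A.IsMorphism A' Φ f) (χc : IsManifold.maximalAtlas (𝓡 n) ∞ M × C)
    (χc' : IsManifold.maximalAtlas (𝓡 n') ∞ M' × C') :
    ∃ P : ι' × MultiIndexLE n' k → M → MvPolynomial (ι × MultiIndexLE n k) ℝ,
      (∀ i d, ContMDiffOn (𝓡 n) 𝓘(ℝ, ℝ) ∞ (fun x => (P i x).coeff d)
        ((A.jetAtlas k).domain χc ∩ f ⁻¹' (A'.jetAtlas k).domain χc')) ∧
      (∀ i, ∀ x ∈ (A.jetAtlas k).domain χc ∩ f ⁻¹' (A'.jetAtlas k).domain χc', ∀ a,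
        (P i x).weightedTotalDegree (fun j => (A.jetAtlas k).weight j a) ≤
          (A'.jetAtlas k).weight i a) ∧
      ∀ x ∈ (A.jetAtlas k).domain χc ∩ f ⁻¹' (A'.jetAtlas k).domain χc', ∀ s : M → E,
        A.IsSectionNear x s → ∀ iβ : ι' × MultiIndexLE n' k,
          multiIndexDeriv iβ.2.1 (A'.localRep χc'.1.1 χc'.2 fun y => Φ (s (f.symm y)))
            (χc'.1.1 (f x)) iβ.1 =
          MvPolynomial.eval (fun jγ => multiIndexDeriv jγ.2.1 (A.localRep χc.1.1 χc.2 s)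
            (χc.1.1 x) jγ.1) (P iβ x) := by
  obtain ⟨⟨χ, hχ⟩, c⟩ := χc
  obtain ⟨⟨χ', hχ'⟩, c'⟩ := χc'
  dsimp only
  set D : Set M := (A.jetAtlas k).domain (⟨χ, hχ⟩, c) ∩
      f ⁻¹' (A'.jetAtlas k).domain (⟨χ', hχ'⟩, c')
    with hDdef
  have hD : IsOpen D := (isOpen_jetAtlas_domain hA _).inter
    ((isOpen_jetAtlas_domain hA' _).preimage f.continuous)
  have hDsub : D ⊆ A.domain c ∩ f ⁻¹' A'.domain c' := fun x hx => ⟨hx.1.2, hx.2.2⟩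
  obtain ⟨P, hP, hdeg, heq⟩ := hΦ.polynomial c c'
  -- The computation takes place in the coordinates `χ'` of the target base, since the push-forward
  -- is differentiated in these.
  set V : Set (EuclideanSpace ℝ (Fin n')) := χ'.target ∩ χ'.symm ⁻¹' (f.symm ⁻¹' D) with hVdef
  have hV : IsOpen V := χ'.isOpen_inter_preimage_symm (hD.preimage f.symm.continuous)
  set σ : EuclideanSpace ℝ (Fin n') → M := fun z => f.symm (χ'.symm z) with hσdef
  have hσ : ∀ z ∈ V, ContMDiffAt (𝓡 n') (𝓡 n) ∞ σ z := fun z hz =>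
    f.symm.contMDiff.contMDiffAt.comp z (contMDiffAt_symm_of_mem_maximalAtlas hχ' hz.1)
  have hτ : ContDiffOn ℝ ∞ (fun z => χ (σ z)) V := fun z hz => by
    refine ContDiffAt.contDiffWithinAt ?_
    rw [← contMDiffAt_iff_contDiffAt]
    exact (contMDiffAt_of_mem_maximalAtlas hχ hz.2.1.1).comp z (hσ z hz)
  have hQ : ∀ i, ∃ Q, IsJetPolynomial (n := n) (fun j => A.weight j 0) V (A'.weight i 0) 0 Q ∧
      ∀ z ∈ V, ∀ Y, Q z Y = MvPolynomial.eval (fun j => Y (j, 0)) (P i (σ z)) := fun i =>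
    exists_isJetPolynomial_eval (fun j => A.weight j 0)
      (fun j h => hA.weight_ne_zero j (funext fun a => by rw [Subsingleton.elim a 0]; exact h))
      (A'.weight i 0) V (fun z => P i (σ z))
      (fun d z hz => ContDiffAt.contDiffWithinAt (by
        rw [← contMDiffAt_iff_contDiffAt]
        exact (((hP i d).mono hDsub).contMDiffAt (hD.mem_nhds hz.2)).comp z (hσ z hz)))
      fun z hz => hdeg i _ (hDsub hz.2) 0
  choose Q hQ hQeval using hQ
  choose Q' hQ' hQu using fun β : Fin n' → ℕ => IsJetPolynomial.exists_multiIndexDeriv hQ hV hτ β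
  choose R hR hdR heR using fun iβ : ι' × MultiIndexLE n' k =>
    (hQ' iβ.2.1 iβ.1).exists_mvPolynomial iβ.2.2
  have hmaps : ∀ x ∈ D, χ' (f x) ∈ V := fun x hx =>
    ⟨χ'.map_source hx.2.1, by simpa [χ'.left_inv hx.2.1] using hx⟩
  have hσx : ∀ x ∈ D, σ (χ' (f x)) = x := fun x hx => by simp [hσdef, χ'.left_inv hx.2.1]
  -- The coefficients, functions of the `χ'`-coordinates, are pulled back to `M` along χ' ∘ f.
  refine ⟨fun iβ x => R iβ (χ' (f x)), fun iβ d x hx => ContMDiffAt.contMDiffWithinAt ?_,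
    fun iβ x _ => jetAtlas_weightedTotalDegree_le (hdR iβ _), fun x hx s hs iβ => ?_⟩
  · have h1 := ((hR iβ d).contDiffAt (hV.mem_nhds (hmaps x hx))).contMDiffAt
    exact h1.comp (I' := 𝓡 n') (f := fun y => χ' (f y)) x
      ((contMDiffAt_of_mem_maximalAtlas hχ' hx.2.1).comp x f.contMDiff.contMDiffAt)
  · obtain ⟨U, hU, hxU, -, hproj, hsm⟩ := hs.exists_contDiffOn_localRep hA hχ hx.1.1 hx.1.2
    have hτx : χ (σ (χ' (f x))) = χ x := by rw [hσx x hx]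
    have hxU' : χ (σ (χ' (f x))) ∈ U := by rwa [hτx]
    have hW : IsOpen (V ∩ (fun z => χ (σ z)) ⁻¹' U) :=
      hτ.continuousOn.isOpen_inter_preimage hV hU
    have hrep : A'.localRep χ' c' (fun y => Φ (s (f.symm y))) =ᶠ[𝓝 (χ' (f x))] fun z i =>
        Q i z fun jγ => multiIndexDeriv jγ.2 (A.localRep χ c s) (χ (σ z)) jγ.1 := by
      filter_upwards [hW.mem_nhds ⟨hmaps x hx, hxU'⟩] with z hz
      funext i
      have hσz : χ.symm (χ (σ z)) = σ z := χ.left_inv hz.1.2.1.1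
      have hp : A.proj (s (σ z)) = σ z := by simpa [hσz] using hproj _ hz.2
      have h1 := heq (s (σ z)) (by rw [hp]; exact hDsub hz.1.2) i
      rw [hp] at h1
      rw [hQeval i z hz.1]
      simpa [multiIndexDeriv_zero, localRep, hσz] using h1
    rw [hrep.multiIndexDeriv_eq, hQu iβ.2.1 _ U hU hsm _ (hmaps x hx) hxU', heR, hτx]

/-! ### Prolonged morphisms and transition maps. -/

theorem IsMorphism.jetProlongation [IsManifold (𝓡 n) ∞ M] (hA : A.IsFilteredBundle l)
    (hA' : A'.IsFilteredBundle m) {Φ : E → E'} (f : M ≃ₘ⟮𝓡 n, 𝓡 n'⟯ M')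
    (hΦ : A.IsMorphism A' Φ f) :
    (A.jetAtlas k).IsMorphism (A'.jetAtlas k) (jetProlongation hA hA' Φ f hΦ k) f where
  smooth_base := f.contMDiff
  proj_comp _ := rfl
  polynomial χc χc' := by
    obtain ⟨P, hP, hdeg, heq⟩ :=
      hΦ.exists_multiIndexDeriv_localRep_push (k := k) hA hA' f χc χc'
    refine ⟨P, hP, hdeg, fun p hp i => ?_⟩
    obtain ⟨x, s, rfl⟩ := exists_eq_jet p
    have hcoord : (A.jetAtlas k).coord χc (A.jet k x s) = fun jγ =>
        multiIndexDeriv jγ.2.1 (A.localRep χc.1.1 χc.2 s.1) (χc.1.1 x) jγ.1 :=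
      funext fun jγ => jetCoord_jet s hp.1 jγ
    rw [hcoord]
    exact (jetCoord_jet (⟨fun y => Φ (s.1 (f.symm y)), hΦ.isSectionNear_push hA hA' f s.2⟩ :
      A'.LocalSection (f x)) hp.2 i).trans (heq x hp s.1 s.2 i)

theorem jetAtlas_transition [IsManifold (𝓡 n) ∞ M] (hA : A.IsFilteredBundle l)
    (χc χc' : IsManifold.maximalAtlas (𝓡 n) ∞ M × C) :
    (A.jetAtlas k).IsFilteredPolynomial (A.jetAtlas k) id id χc χc' := by
  obtain ⟨P, hP, hdeg, heq⟩ :=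
    (hA.isMorphism_refl.jetProlongation (k := k) hA hA (Diffeomorph.refl (𝓡 n) M ∞)).polynomial
      χc χc'
  refine ⟨P, hP, hdeg, fun p hp i => ?_⟩
  obtain ⟨x, s, rfl⟩ := exists_eq_jet p
  -- On the jet of a given section, the prolongation of the identity is the identity by definition.
  exact heq _ hp i

/-! ### Local triviality of the jet bundle. -/

/-- A jet is determined by its coordinates in one chart. -/
theorem jetAtlas_coord_injective [IsManifold (𝓡 n) ∞ M] (hA : A.IsFilteredBundle l) {x : M}
    {χc : IsManifold.maximalAtlas (𝓡 n) ∞ M × C} (hx : x ∈ (A.jetAtlas k).domain χc)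
    {s t : A.LocalSection x}
    (hst : (A.jetAtlas k).coord χc (A.jet k x s) = (A.jetAtlas k).coord χc (A.jet k x t)) :
    A.jet k x s = A.jet k x t := by
  refine congrArg (Sigma.mk x) (Quotient.sound fun χ hχ c hxχ hxc q hq => ?_)
  have hx' : x ∈ (A.jetAtlas k).domain (⟨χ, hχ⟩, c) := ⟨hxχ, hxc⟩
  -- Contact is tested in all charts; the transition polynomials carry the equality of coordinates
  -- from `χc` to an arbitrary one.
  obtain ⟨P, -, -, heq⟩ := jetAtlas_transition (k := k) hA χc (⟨χ, hχ⟩, c)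
  have hcoord : (A.jetAtlas k).coord (⟨χ, hχ⟩, c) (A.jet k x s) =
      (A.jetAtlas k).coord (⟨χ, hχ⟩, c) (A.jet k x t) := funext fun i =>
    (heq (A.jet k x s) ⟨hx, hx'⟩ i).trans
      ((congrArg (fun v => MvPolynomial.eval v (P i x)) hst).trans
        (heq (A.jet k x t) ⟨hx, hx'⟩ i).symm)
  obtain ⟨U, hU, hxU, -, -, hsm⟩ := s.2.exists_contDiffOn_localRep hA hχ hxχ hxc
  obtain ⟨W, hW, hxW, -, -, htm⟩ := t.2.exists_contDiffOn_localRep hA hχ hxχ hxc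
  refine iteratedFDeriv_eq_of_multiIndexDeriv_eq hsm hU hxU htm hW hxW fun β hβ => funext fun i => ?_
  have h := congrFun hcoord (i, ⟨β, hβ.trans_le hq⟩)
  rwa [jetCoord_jet s hx', jetCoord_jet t hx'] at h

/-- A smooth map into the typical fibre defines a local section. -/
theorem exists_localSection_coord_eq {A : FibreAtlas n r M E C ι} {deg : Fin r → ℕ}
    (hA : A.IsMultiFilteredBundle deg) {χ : OpenPartialHomeomorph M (EuclideanSpace ℝ (Fin n))}
    (hχ : χ ∈ IsManifold.maximalAtlas (𝓡 n) ∞ M) {x : M} (hx : x ∈ χ.source) {c : C}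
    (hc : x ∈ A.domain c) {u : EuclideanSpace ℝ (Fin n) → ι → ℝ} (hu : ContDiff ℝ ∞ u) :
    ∃ s : A.LocalSection x, A.localRep χ c s.1 =ᶠ[𝓝 (χ x)] u := by
  obtain ⟨e, he, hcoord⟩ := hA.trivialization c
  set W : Set M := χ.source ∩ A.domain c with hWdef
  have hW : IsOpen W := χ.open_source.inter (hA.isOpen_domain c)
  set s : M → E := fun y => e.toOpenPartialHomeomorph.symm (y, u (χ y)) with hsdef
  have hmem : ∀ y ∈ W, (y, u (χ y)) ∈ e.target := fun y hy =>
    e.mem_target.2 (by rw [he]; exact hy.2)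
  have hs : ∀ y ∈ W, A.proj (s y) = y ∧ A.coord c (s y) = u (χ y) := fun y hy => by
    have h1 := hcoord _ (e.map_target (hmem y hy))
    have h2 : e (s y) = (y, u (χ y)) := e.apply_symm_apply (hmem y hy)
    exact Prod.ext_iff.1 (h1.symm.trans h2)
  have huW : ∀ y ∈ W, ContMDiffAt (𝓡 n) 𝓘(ℝ, ι → ℝ) ∞ (fun y => u (χ y)) y := fun y hy =>
    hu.contMDiff.contMDiffAt.comp y (contMDiffAt_of_mem_maximalAtlas hχ hy.1)
  refine ⟨⟨s, W, hW, ⟨hx, hc⟩, fun y hy => (hs y hy).1, fun c' y hy =>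
    ContMDiffAt.contMDiffWithinAt (contMDiffAt_pi_space.2 fun i => ?_)⟩, ?_⟩
  · obtain ⟨P, hP, hdeg, heq⟩ := hA.transition c c'
    have hV : IsOpen (A.domain c ∩ id ⁻¹' A.domain c') :=
      (hA.isOpen_domain c).inter (hA.isOpen_domain c')
    refine (contMDiffAt_eval (𝓡 n) A.weight hA.weight_ne_zero (A.weight i) _ hV (P i) (hP i)
      (hdeg i) id (fun y => u (χ y)) y ⟨hy.1.2, hy.2⟩ contMDiffAt_id
      (huW y hy.1)).congr_of_eventuallyEq ?_
    filter_upwards [(hW.inter (hA.isOpen_domain c')).mem_nhds hy] with z hz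
    have h := heq (s z) (by rw [(hs z hz.1).1]; exact ⟨hz.1.2, hz.2⟩) i
    rwa [(hs z hz.1).1, (hs z hz.1).2] at h
  · filter_upwards [(χ.isOpen_inter_preimage_symm hW).mem_nhds
      ⟨χ.map_source hx, by simpa [χ.left_inv hx] using ⟨hx, hc⟩⟩] with z hz
    simpa [localRep, χ.right_inv hz.1] using (hs _ hz.2).2

/-- The jet coordinates of the jets at a point take all values. -/
theorem exists_jetAtlas_coord_eq (hA : A.IsFilteredBundle l) {x : M}
    {χc : IsManifold.maximalAtlas (𝓡 n) ∞ M × C} (hx : x ∈ (A.jetAtlas k).domain χc)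
    (y : ι × MultiIndexLE n k → ℝ) :
    ∃ s : A.LocalSection x, (A.jetAtlas k).coord χc (A.jet k x s) = y := by
  obtain ⟨u, hu, huy⟩ := exists_contDiff_multiIndexDeriv_eq y (χc.1.1 x)
  obtain ⟨s, hs⟩ := exists_localSection_coord_eq hA χc.1.2 hx.1 hx.2 hu
  refine ⟨s, funext fun iβ => ?_⟩
  rw [jetCoord_jet s hx, hs.multiIndexDeriv_eq, huy]

theorem exists_mem_jetAtlas_domain [IsManifold (𝓡 n) ∞ M] (hA : A.IsFilteredBundle l) (x : M) :
    ∃ χc, x ∈ (A.jetAtlas k).domain χc := by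
  obtain ⟨c, hc⟩ := hA.cover x
  exact ⟨(⟨chartAt _ x, IsManifold.chart_mem_maximalAtlas x⟩, c), mem_chart_source _ x, hc⟩

/-- The inverse of the local trivialization of the jet bundle. -/
theorem exists_jetAtlas_inverse [IsManifold (𝓡 n) ∞ M] (hA : A.IsFilteredBundle l)
    (χc : IsManifold.maximalAtlas (𝓡 n) ∞ M × C) :
    ∃ g : M × (ι × MultiIndexLE n k → ℝ) → A.JetSpace k, ∀ xy, (A.jetAtlas k).proj (g xy) = xy.1 ∧
      (xy.1 ∈ (A.jetAtlas k).domain χc → (A.jetAtlas k).coord χc (g xy) = xy.2) := by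
  suffices h : ∀ xy : M × (ι × MultiIndexLE n k → ℝ), ∃ p : A.JetSpace k,
      (A.jetAtlas k).proj p = xy.1 ∧
        (xy.1 ∈ (A.jetAtlas k).domain χc → (A.jetAtlas k).coord χc p = xy.2) from
    ⟨fun xy => (h xy).choose, fun xy => (h xy).choose_spec⟩
  intro xy
  by_cases hx : xy.1 ∈ (A.jetAtlas k).domain χc
  · obtain ⟨s, hs⟩ := exists_jetAtlas_coord_eq hA hx xy.2
    exact ⟨A.jet k xy.1 s, rfl, fun _ => hs⟩
  · obtain ⟨χc', hx'⟩ := exists_mem_jetAtlas_domain (k := k) hA xy.1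
    obtain ⟨s, -⟩ := exists_jetAtlas_coord_eq hA hx' xy.2
    exact ⟨A.jet k xy.1 s, rfl, fun h => absurd h hx⟩

theorem jetAtlas_weight_ne_zero (hA : A.IsFilteredBundle l) (i : ι × MultiIndexLE n k) :
    (A.jetAtlas k).weight i ≠ 0 := fun h =>
  hA.weight_ne_zero i.1 (funext fun a => by rw [Subsingleton.elim a 0]; exact congrFun h 0)

theorem exists_jetAtlas_trivialization [IsManifold (𝓡 n) ∞ M] (hA : A.IsFilteredBundle l)
    (χc : IsManifold.maximalAtlas (𝓡 n) ∞ M × C) :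
    ∃ e : Bundle.Trivialization (ι × MultiIndexLE n k → ℝ) (A.jetAtlas k).proj,
      e.baseSet = (A.jetAtlas k).domain χc ∧
      ∀ p ∈ e.source, e p = ((A.jetAtlas k).proj p, (A.jetAtlas k).coord χc p) := by
  obtain ⟨g, hg⟩ := exists_jetAtlas_inverse (k := k) hA χc
  set D := (A.jetAtlas k).domain χc with hDdef
  have hD : IsOpen D := isOpen_jetAtlas_domain hA χc
  have hgen : ∀ W : Set (M × (ι × MultiIndexLE n k → ℝ)), IsOpen W →
      IsOpen ((A.jetAtlas k).proj ⁻¹' D ∩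
        (fun p => ((A.jetAtlas k).proj p, (A.jetAtlas k).coord χc p)) ⁻¹' W) := fun W hW =>
    TopologicalSpace.isOpen_generateFrom_of_mem ⟨χc, W, hW, rfl⟩
  have hsource : IsOpen ((A.jetAtlas k).proj ⁻¹' D) := by simpa using hgen Set.univ isOpen_univ
  refine ⟨{
    toFun := fun p => ((A.jetAtlas k).proj p, (A.jetAtlas k).coord χc p)
    invFun := g
    source := (A.jetAtlas k).proj ⁻¹' D
    target := D ×ˢ Set.univ
    map_source' := fun p hp => ⟨hp, Set.mem_univ _⟩
    map_target' := fun xy hxy => by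
      rw [Set.mem_preimage, (hg xy).1]; exact hxy.1
    left_inv' := fun p hp => ?_
    right_inv' := fun xy hxy => Prod.ext (hg xy).1 ((hg xy).2 hxy.1)
    open_source := hsource
    open_target := hD.prod isOpen_univ
    continuousOn_toFun := (continuousOn_open_iff hsource).2 hgen
    continuousOn_invFun := ?_
    baseSet := D
    open_baseSet := hD
    source_eq := rfl
    target_eq := rfl
    proj_toFun := fun _ _ => rfl }, rfl, fun _ _ => rfl⟩
  -- A point and its image under the round trip have the same base point and the same coordinates.
  -- The base points are identified first, since jets at different points lie in different quotient
  -- types.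
  · obtain ⟨h1, h2⟩ := hg ((A.jetAtlas k).proj p, (A.jetAtlas k).coord χc p)
    have h3 := h2 hp
    generalize g ((A.jetAtlas k).proj p, (A.jetAtlas k).coord χc p) = p' at h1 h3
    obtain ⟨x, s, rfl⟩ := exists_eq_jet p
    obtain ⟨x', t, rfl⟩ := exists_eq_jet p'
    obtain rfl : x' = x := h1
    exact jetAtlas_coord_injective hA hp h3
  -- It suffices to test generating open sets. Read in the chart `χc'` of such a set, `g` is the
  -- transition map, which is continuous where the two domains overlap.
  · refine continuousOn_isOpen_of_generateFrom ?_
    rintro _ ⟨χc', W, hW, rfl⟩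
    obtain ⟨P, hP, hdeg, heq⟩ := jetAtlas_transition (k := k) hA χc χc'
    set D' := D ∩ id ⁻¹' (A.jetAtlas k).domain χc' with hD'def
    have hD' : IsOpen D' := hD.inter (isOpen_jetAtlas_domain (k := k) hA χc')
    have hcont : ContinuousOn (fun xy : M × (ι × MultiIndexLE n k → ℝ) =>
        (xy.1, fun i => MvPolynomial.eval xy.2 (P i xy.1))) (D' ×ˢ Set.univ) := by
      refine continuousOn_fst.prodMk (continuousOn_pi.2 fun i xy hxy =>
        ContinuousAt.continuousWithinAt ?_)
      exact (contMDiffAt_eval ((𝓡 n).prod 𝓘(ℝ, ι × MultiIndexLE n k → ℝ)) (A.jetAtlas k).weight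
        (jetAtlas_weight_ne_zero hA) ((A.jetAtlas k).weight i) D' hD' (P i) (hP i) (hdeg i)
        Prod.fst Prod.snd xy hxy.1 contMDiffAt_fst contMDiffAt_snd).continuousAt
    convert hcont.isOpen_inter_preimage (hD'.prod isOpen_univ) hW using 1
    ext xy
    have hiff : xy ∈ D' ×ˢ (Set.univ : Set (ι × MultiIndexLE n k → ℝ)) →
        ((A.jetAtlas k).proj (g xy), (A.jetAtlas k).coord χc' (g xy)) =
          (xy.1, fun i => MvPolynomial.eval xy.2 (P i xy.1)) := fun hxy => by
      obtain ⟨h1, h2⟩ := hg xy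
      refine Prod.ext h1 (funext fun i => ?_)
      have h := heq (g xy) (by rw [h1]; exact hxy.1) i
      rwa [h1, h2 hxy.1.1] at h
    constructor
    · rintro ⟨hxy, hxD, hxW⟩
      have hxy' : xy ∈ D' ×ˢ (Set.univ : Set (ι × MultiIndexLE n k → ℝ)) :=
        ⟨⟨hxy.1, by rw [(hg xy).1] at hxD; exact hxD⟩, Set.mem_univ _⟩
      refine ⟨hxy', ?_⟩
      rw [hiff hxy'] at hxW
      exact hxW
    · rintro ⟨hxy', hxW⟩
      refine ⟨⟨hxy'.1.1, Set.mem_univ _⟩, ?_, ?_⟩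
      · rw [(hg xy).1]; exact hxy'.1.2
      · rw [hiff hxy']; exact hxW

theorem IsMultiFilteredBundle.jetAtlas [IsManifold (𝓡 n) ∞ M] (hA : A.IsFilteredBundle l) :
    (A.jetAtlas k).IsDoubleFilteredBundle l k where
  finite_rank := inferInstance
  weight_ne_zero := jetAtlas_weight_ne_zero hA
  weight_le i a := by
    fin_cases a
    exacts [hA.weight_le i.1 0, i.2.2]
  trivialization := exists_jetAtlas_trivialization hA
  cover := exists_mem_jetAtlas_domain hA
  transition := jetAtlas_transition hA

end JetFormula

end FibreAtlas
end

theorem mainTheorem8 {n n' l m : ℕ} {M M' F F' C C' ι ι' : Type*}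
    [TopologicalSpace M] [ChartedSpace (EuclideanSpace ℝ (Fin n)) M] [IsManifold (𝓡 n) ∞ M]
    [TopologicalSpace M'] [ChartedSpace (EuclideanSpace ℝ (Fin n')) M'] [IsManifold (𝓡 n') ∞ M']
    [TopologicalSpace F] [TopologicalSpace F'] [Fintype ι] [Fintype ι']
    (A : FibreAtlas n 1 M F C ι) (hA : A.IsFilteredBundle l)
    (A' : FibreAtlas n' 1 M' F' C' ι') (hA' : A'.IsFilteredBundle m)
    (φ : F → F') (f : M ≃ₘ⟮𝓡 n, 𝓡 n'⟯ M') (hφ : A.IsMorphism A' φ f) (k : ℕ) :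
    (A.jetAtlas k).IsDoubleFilteredBundle l k ∧
    (A'.jetAtlas k).IsDoubleFilteredBundle m k ∧
    (A.jetAtlas k).IsMorphism (A'.jetAtlas k)
      (FibreAtlas.jetProlongation hA hA' φ f hφ k) f :=
  ⟨FibreAtlas.IsMultiFilteredBundle.jetAtlas hA, FibreAtlas.IsMultiFilteredBundle.jetAtlas hA',
    FibreAtlas.IsMorphism.jetProlongation hA hA' f hφ⟩
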